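/- Let $N_n,N_f\ge 1$ be integers, $\Omega_p,\Omega_n,\Omega_f>0$, $I>0$, $0<\delta<1$, $P_{\mathrm{peak}}>0$, and $a_n,a_f>0$ with $a_n+a_f=1$. Let $h_p\sim\mathcal{CN}(0,\Omega_p)$, let $h_{n,1},\dots,h_{n,N_n}\sim\mathcal{CN}(0,\Omega_n)$ and $h_{f,1},\dots,h_{f,N_f}\sim\mathcal{CN}(0,\Omega_f)$, where the $N_n+N_f$ variables $h_{n,i},h_{f,j}$ are mutually independent, and put $g_p=|h_p|^2$, $g_n=\sum_i|h_{n,i}|^2$, $g_f=\sum_j|h_{f,j}|^2$, $g_{\min}=\min\{g_n,g_f\}$. For a constant transmit power $P\ge 0$ the average NOMA sum-rate is $$C(P)=\mathbb E\Big[\log_2(1+a_ng_nP)+\min_{u\in\{n,f\}}\log_2\Big(1+\frac{a_fg_uP}{a_ng_uP+1}\Big)\Big].$$ Then, for every $P\ge0$, all the variables whose expectations occur here are integrable and $$C(P)=\mathbb E[\log_2(1+a_ng_nP)]+\mathbb E[\log_2(1+g_{\min}P)]-\mathbb E[\log_2(1+a_ng_{\min}P)].$$ (1) (IntSCSI: interference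 constraint, statistical interference-link information.) Over all $P\ge0$ with $\Pr(g_pP>I)\le\delta$, the sum-rate $C(P)$ attains its maximum at the feasible power $P_t^*=-I/(\Omega_p\ln\delta)$, and, with $\Omega=\Omega_n\Omega_f/(\Omega_n+\Omega_f)$ and $$\mathcal G_N(z)=G^{3,1}_{2,3}\left(z\,\middle|\,\begin{matrix}-N,\ 1-N\\ 0,\ -N,\ -N\end{matrix}\right),$$ this maximum is $$\begin{aligned}C(P_t^*)=\frac1{\ln 2}\Bigg[&\frac{1}{\Gamma(N_n)\Omega_n^{N_n}(a_nP_t^*)^{N_n}}\,\mathcal G_{N_n}\!\Big(\frac1{\Omega_na_nP_t^*}\Big)\\ &+\frac1{\Gamma(N_n)\Omega_n^{N_n}}\sum_{k=0}^{N_f-1}\frac1{k!\,\Omega_f^k(P_t^*)^{N_n+k}}\Big\{\mathcal G_{N_n+k}\!\Big(\frac1{\Omega P_t^*}\Big)-\frac1{a_n^{N_n+k}}\mathcal G_{N_n+k}\!\Big(\frac1{\Omega a_nP_t^*}\Big)\Big\}\\ &+\frac1{\Gamma(N_f)\Omega_f^{N_f}}\sum_{l=0}^{N_n-1}\frac1{l!\,\Omega_n^l(P_t^*)^{N_f+l}}\Big\{\mathcal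 G_{N_f+l}\!\Big(\frac1{\Omega P_t^*}\Big)-\frac1{a_n^{N_f+l}}\mathcal G_{N_f+l}\!\Big(\frac1{\Omega a_nP_t^*}\Big)\Big\}\Bigg].\end{aligned}$$ (2) (PowIntSCSI: additional peak power budget.) Over all $0\le P\le P_{\mathrm{peak}}$ with $\Pr(g_pP\ge I)\le\delta$, the sum-rate $C(P)$ attains its maximum at the feasible power $P_t^*=\min\{P_{\mathrm{peak}},-I/(\Omega_p\ln\delta)\}$, and $C(P_t^*)$ is given by the same formula with this $P_t^*$. Here, for integers $N\ge1$ and real $z>0$, Meijer's function is the Mellin–Barnes integral $$\mathcal G_N(z)=\frac1{2\pi i}\int_{c-i\infty}^{c+i\infty}\frac{\Gamma(-s)\,\Gamma(-N-s)^2\,\Gamma(1+N+s)}{\Gamma(1-N-s)}\,z^s\,ds ,$$ along any line with $-N-1<c<-N$ (the lines that separate the poles of $\Gamma(-s)$ and $\Gamma(-N-s)$ from those of $\Gamma(1+N+s)$); this integral converges absolutely and does not depend on $c$. -/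

import Mathlib

open MeasureTheory ProbabilityTheory

noncomputable section

/-- The integrand of the Mellin-Barnes representation of the Meijer function `G^{m,n}_{p,q}`:
`∏_{j ≤ m} Γ(b_j - s) ∏_{j ≤ n} Γ(1 - a_j + s) /
  (∏_{j > m} Γ(1 - b_j + s) ∏_{j > n} Γ(a_j - s)) * z ^ s`. The lists are indexed from zero here. -/
def meijerGIntegrand {p q : ℕ} (m n : ℕ) (a : Fin p → ℂ) (b : Fin q → ℂ) (z s : ℂ) : ℂ :=
  (∏ j : Fin q, if (j : ℕ) < m then Complex.Gamma (b j - s)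
      else (Complex.Gamma (1 - b j + s))⁻¹) *
  (∏ j : Fin p, if (j : ℕ) < n then Complex.Gamma (1 - a j + s)
      else (Complex.Gamma (a j - s))⁻¹) * z ^ s

/-- The upward line `Re s = c` separates the poles of the factors `Γ(b_j - s)`, `j ≤ m`,
(the points `b_j + k`, on its right) from those of the factors `Γ(1 - a_j + s)`, `j ≤ n`,
(the points `a_j - 1 - k`, on its left). -/
def IsMeijerGLine {p q : ℕ} (m n : ℕ) (a : Fin p → ℂ) (b : Fin q → ℂ) (c : ℝ) : Prop :=
  (∀ j : Fin q, (j : ℕ) < m → c < (b j).re) ∧ (∀ j : Fin p, (j : ℕ) < n → (a j).re - 1 < c)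

/-- `(1 / (2 π i)) ∫ ds` of the Mellin-Barnes integrand along the line `Re s = c`. -/
def meijerGLineIntegral {p q : ℕ} (m n : ℕ) (a : Fin p → ℂ) (b : Fin q → ℂ) (z : ℂ) (c : ℝ) : ℂ :=
  (1 / (2 * (Real.pi : ℂ))) * ∫ t : ℝ, meijerGIntegrand m n a b z ((c : ℂ) + (t : ℂ) * Complex.I)

open Classical in
/-- Meijer's G-function `G^{m,n}_{p,q}(z | a; b)` for parameters whose two families of poles are
separated by a vertical line: the Mellin-Barnes integral along such a line. (The value `0`
for parameters which admit no such line is a convention.) -/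
def meijerG {p q : ℕ} (m n : ℕ) (a : Fin p → ℂ) (b : Fin q → ℂ) (z : ℂ) : ℂ :=
  if h : ∃ c : ℝ, IsMeijerGLine m n a b c then meijerGLineIntegral m n a b z h.choose else 0

/-- `G^{m,n}_{p,q}(z | a; b)` is properly defined by the straight-line Mellin-Barnes integral:
there is a separating line, and along each of them the integral converges absolutely and has the
same value. -/
def MeijerGWellDefined {p q : ℕ} (m n : ℕ) (a : Fin p → ℂ) (b : Fin q → ℂ) (z : ℂ) : Prop :=
  (∃ c : ℝ, IsMeijerGLine m n a b c) ∧
  ∀ c : ℝ, IsMeijerGLine m n a b c →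
    Integrable (fun t : ℝ => meijerGIntegrand m n a b z ((c : ℂ) + (t : ℂ) * Complex.I)) ∧
    meijerGLineIntegral m n a b z c = meijerG m n a b z

/-- The upper parameters `(-N, 1 - N)`. -/
def rateUpper (N : ℕ) : Fin 2 → ℂ := ![-(N : ℂ), 1 - (N : ℂ)]

/-- The lower parameters `(0, -N, -N)`. -/
def rateLower (N : ℕ) : Fin 3 → ℂ := ![0, -(N : ℂ), -(N : ℂ)]

/-- `G^{3,1}_{2,3}(z | -N, 1 - N; 0, -N, -N)`. -/
def rateG (N : ℕ) (z : ℝ) : ℂ := meijerG 3 1 (rateUpper N) (rateLower N) (z : ℂ)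

/-- The closed form of the sum-rate at transmit power `P`. -/
def sumRateClosedForm (Nn Nf : ℕ) (Ωn Ωf an P : ℝ) : ℂ :=
  let Ω : ℝ := Ωn * Ωf / (Ωn + Ωf)
  (1 / (Real.log 2 : ℂ)) *
    (1 / ((Real.Gamma Nn : ℂ) * (Ωn : ℂ) ^ Nn * ((an : ℂ) * (P : ℂ)) ^ Nn)
        * rateG Nn (1 / (Ωn * an * P))
      + 1 / ((Real.Gamma Nn : ℂ) * (Ωn : ℂ) ^ Nn) *
          ∑ k ∈ Finset.range Nf,
            1 / ((Nat.factorial k : ℂ) * (Ωf : ℂ) ^ k * (P : ℂ) ^ (Nn + k)) *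
              (rateG (Nn + k) (1 / (Ω * P))
                - 1 / (an : ℂ) ^ (Nn + k) * rateG (Nn + k) (1 / (Ω * an * P)))
      + 1 / ((Real.Gamma Nf : ℂ) * (Ωf : ℂ) ^ Nf) *
          ∑ l ∈ Finset.range Nn,
            1 / ((Nat.factorial l : ℂ) * (Ωn : ℂ) ^ l * (P : ℂ) ^ (Nf + l)) *
              (rateG (Nf + l) (1 / (Ω * P))
                - 1 / (an : ℂ) ^ (Nf + l) * rateG (Nf + l) (1 / (Ω * an * P))))

/-- The circularly symmetric complex normal law `CN(0, v)`: independent real and imaginary parts,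
each centred normal with variance `v / 2`. -/
def complexNormal (v : ℝ) : Measure ℂ :=
  ((gaussianReal 0 (v / 2).toNNReal).prod (gaussianReal 0 (v / 2).toNNReal)).map
    Complex.measurableEquivRealProd.symm

section Model

variable {S : Type*}

/-- The channel gain `hᴴ h` after maximal-ratio combining over `N` antennas. -/
def mrcGain {N : ℕ} (h : Fin N → S → ℂ) (ω : S) : ℝ := ∑ i, ‖h i ω‖ ^ 2

/-- The SINR with which a user with gain `g` decodes the far user's symbol. -/
def sinrFar (an af g P : ℝ) : ℝ := af * g * P / (an * g * P + 1)

/-- The instantaneous rate of the near user. -/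
def rateNear (an gn P : ℝ) : ℝ := Real.logb 2 (1 + an * gn * P)

/-- The instantaneous rate of the far user, whose symbol has to be decoded by both users. -/
def rateFar (an af gn gf P : ℝ) : ℝ :=
  min (Real.logb 2 (1 + sinrFar an af gn P)) (Real.logb 2 (1 + sinrFar an af gf P))

/-- The instantaneous NOMA sum-rate at transmit power `P`. -/
def sumRate (an af gn gf P : ℝ) : ℝ := rateNear an gn P + rateFar an af gn gf P

/-- The average NOMA sum-rate when the transmitter uses the constant power `P`. -/
def avgSumRate [MeasurableSpace S] (μ : Measure S) (gn gf : S → ℝ) (an af P : ℝ) : ℝ :=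
  ∫ ω, sumRate an af (gn ω) (gf ω) P ∂μ

/-- Constant powers for which the interference `g_p P` at the primary receiver exceeds `I` with
probability at most `δ`. -/
def powersInt [MeasurableSpace S] (μ : Measure S) (gp : S → ℝ) (I δ : ℝ) : Set ℝ :=
  {P | 0 ≤ P ∧ μ.real {ω | gp ω * P > I} ≤ δ}

/-- Constant powers for which the interference `g_p P` at the primary receiver reaches `I` with
probability at most `δ`, and which respect the peak power budget. -/
def powersPowInt [MeasurableSpace S] (μ : Measure S) (gp : S → ℝ) (I δ Ppeak : ℝ) : Set ℝ :=
  {P | 0 ≤ P ∧ μ.real {ω | gp ω * P ≥ I} ≤ δ ∧ P ≤ Ppeak}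

end Model

end

/-! Probability side. `hasLaw_mrcGain`: the gains `g_n`, `g_f` have Gamma laws of integral shape.
The SINR increases with the gain, so the minimum over users sits at `g_min`, and `a_n + a_f = 1`
turns `1 + SINR` into `(1 + gP) / (1 + a_n g P)`; this is the splitting into three logarithms
(`rateFar_eq`). For independent gains, `E φ(g_min)` is the integral of `φ` against each law weighted
by the tail of the other (`integral_comp_min_prod`). Such a tail is an exponential times a
polynomial (`gammaMeasure_real_Ioi`), so every expectation is a finite combination of Laplace
transforms `∫ x^(N-1) e^(-zx) log (1 + x) dx` over `x > 0`.

Analytic side. These Laplace transforms are the Meijer functions (`rateG_eq_integral`). On `-1 < Re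
s < 0` the Mellin transform of `log (1 + x)` is `Γ(1+s) Γ(1-s) / s²`. Mellin inversion under the
Laplace integral and Fubini yield a line integral (`laplace_log_one_add`), whose integrand becomes
Meijer's after a shift by `N` and `Γ(1-s) = -s Γ(-s)`.

Optimization. `g_p` is exponential, so each feasible set is an interval `[0, P*]` (`powersInt_eq`,
`powersPowInt_eq`); the rate is nondecreasing in the power for each realization (`sumRate_mono`), so
the right endpoint is optimal. -/

/-! ### Mellin transform of `log (1 + x)` and its inversion. -/

/-- On each vertical line of the right half plane the Gamma function is bounded by its value on
the real axis. -/
lemma Complex.norm_Gamma_le_Gamma_re {s : ℂ} (hs : 0 < s.re) :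
    ‖Complex.Gamma s‖ ≤ Real.Gamma s.re := by
  rw [Complex.Gamma_eq_integral hs, Real.Gamma_eq_integral hs, Complex.GammaIntegral]
  refine (norm_integral_le_integral_norm _).trans (le_of_eq ?_)
  refine setIntegral_congr_fun measurableSet_Ioi fun x hx => ?_
  simp only [norm_mul, Complex.norm_cpow_eq_rpow_re_of_pos hx, Complex.norm_real,
    Complex.sub_re, Complex.one_re, Real.norm_eq_abs, Real.abs_exp]

/-- Subadditivity of `t ↦ t ^ p` combined with `log t ≤ t - 1`. The free exponent serves both ends
of the half-line: `p = 1` near `0`, small `p` near infinity. -/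
lemma Real.log_one_add_le_rpow_div {x p : ℝ} (hx : 0 ≤ x) (hp : 0 < p) (hp1 : p ≤ 1) :
    Real.log (1 + x) ≤ x ^ p / p := by
  have h1 : (1 + x) ^ p ≤ 1 + x ^ p := by
    simpa using Real.rpow_add_le_add_rpow zero_le_one hx hp.le hp1
  have h2 : Real.log ((1 + x) ^ p) ≤ x ^ p := by
    refine (Real.log_le_sub_one_of_pos (by positivity)).trans (by linarith)
  rw [Real.log_rpow (by positivity)] at h2
  rw [le_div_iff₀ hp]
  linarith

lemma mellinConvergent_log_one_add {s : ℂ} (h1 : -1 < s.re) (h0 : s.re < 0) :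
    MellinConvergent (fun x : ℝ => (Real.log (1 + x) : ℂ)) s := by
  have hloc : LocallyIntegrableOn (fun x : ℝ => (Real.log (1 + x) : ℂ)) (Set.Ioi 0) := by
    refine ContinuousOn.locallyIntegrableOn ?_ measurableSet_Ioi
    refine Complex.continuous_ofReal.comp_continuousOn ?_
    refine ContinuousOn.log (by fun_prop) fun x hx => ?_
    have : (0 : ℝ) < x := hx
    positivity
  have key : ∀ {p : ℝ}, 0 < p → p ≤ 1 → ∀ {x : ℝ}, 0 < x →
      ‖(Real.log (1 + x) : ℂ)‖ ≤ 1 / p * ‖x ^ (-(-p))‖ := by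
    intro p hp hp1 x hx
    rw [Complex.norm_real, Real.norm_of_nonneg (Real.log_nonneg (by linarith)), neg_neg,
      Real.norm_of_nonneg (by positivity)]
    refine (Real.log_one_add_le_rpow_div hx.le hp hp1).trans (le_of_eq (by ring))
  -- The decay exponent at infinity must lie strictly between `Re s` and `0`; half of `Re s` does.
  refine mellinConvergent_of_isBigO_rpow (a := s.re / 2) (b := -1) hloc ?_ (by linarith) ?_ h1
  · refine Asymptotics.IsBigO.of_bound (1 / (-(s.re / 2))) ?_
    filter_upwards [Filter.eventually_gt_atTop 0] with x hx
    have := key (p := -(s.re / 2)) (by linarith) (by linarith) hx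
    simpa using this
  · refine Asymptotics.IsBigO.of_bound (1 / 1) ?_
    filter_upwards [self_mem_nhdsWithin] with x hx
    exact key one_pos le_rfl hx

lemma integrable_cpow_mul_exp_neg_mul_Ioi {a : ℂ} {r : ℝ} (ha : 0 < a.re) (hr : 0 < r) :
    IntegrableOn (fun t : ℝ => (t : ℂ) ^ (a - 1) * Complex.exp (-(r * t))) (Set.Ioi 0) := by
  have hreal : IntegrableOn (fun t : ℝ => t ^ (a.re - 1) * Real.exp (-r * t)) (Set.Ioi 0) := by
    simpa using integrableOn_rpow_mul_exp_neg_mul_rpow (p := 1) (s := a.re - 1) (b := r)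
      (by linarith) one_pos hr
  refine hreal.mono' ?_ ?_
  · refine ContinuousOn.aestronglyMeasurable ?_ measurableSet_Ioi
    refine ContinuousOn.mul (fun x hx => ?_) (by fun_prop)
    exact (Complex.continuousAt_ofReal_cpow_const _ _ (Or.inr (ne_of_gt hx))).continuousWithinAt
  · refine (ae_restrict_iff' measurableSet_Ioi).2 (ae_of_all _ fun x hx => ?_)
    rw [norm_mul, Complex.norm_cpow_eq_rpow_re_of_pos hx, Complex.norm_exp]
    simp

lemma integral_exp_neg_mul_Ioi {b : ℝ} (hb : 0 < b) :
    ∫ u in Set.Ioi (0 : ℝ), Real.exp (-(b * u)) = 1 / b := by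
  have := Real.integral_rpow_mul_exp_neg_mul_Ioi one_pos hb
  simpa using this

/-- The Mellin transform of `x ↦ (1 + x)⁻¹` on its strip of convergence. -/
lemma hasMellin_inv_one_add {s : ℂ} (h0 : 0 < s.re) (h1 : s.re < 1) :
    HasMellin (fun x : ℝ => ((1 + x)⁻¹ : ℂ)) s (Complex.Gamma s * Complex.Gamma (1 - s)) := by
  -- Since `(1 + x)⁻¹ = ∫ e^(-(1+x)u) du`, Fubini applies: the `x`-integral gives `Γ(s) u^(-s)`, and
  -- the `u`-integral then gives `Γ(1 - s)`.
  let F : ℝ × ℝ → ℂ := fun p => (p.1 : ℂ) ^ (s - 1) * Complex.exp (-(p.2 * p.1)) *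
    Complex.exp (-p.2)
  have hFmeas : AEStronglyMeasurable F
      ((volume.restrict (Set.Ioi 0)).prod (volume.restrict (Set.Ioi 0))) := by
    rw [Measure.prod_restrict]
    refine ContinuousOn.aestronglyMeasurable ?_ (measurableSet_Ioi.prod measurableSet_Ioi)
    refine ContinuousOn.mul (ContinuousOn.mul (fun p hp => ?_) (by fun_prop)) (by fun_prop)
    have hp1 : (0 : ℝ) < p.1 := hp.1
    exact ((Complex.continuousAt_ofReal_cpow_const p.1 (s - 1) (Or.inr hp1.ne')).comp
      (f := fun p : ℝ × ℝ => p.1) continuousAt_fst).continuousWithinAt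
  have hnorm : ∀ x ∈ Set.Ioi (0 : ℝ), ∀ u : ℝ,
      ‖F (x, u)‖ = x ^ (s.re - 1) * Real.exp (-(u * x)) * Real.exp (-u) := by
    intro x hx u
    simp only [F]
    rw [norm_mul, norm_mul, Complex.norm_cpow_eq_rpow_re_of_pos hx, Complex.norm_exp,
      Complex.norm_exp]
    simp
  have hF : Integrable F ((volume.restrict (Set.Ioi 0)).prod (volume.restrict (Set.Ioi 0))) := by
    rw [integrable_prod_iff' hFmeas]
    constructor
    · refine (ae_restrict_iff' measurableSet_Ioi).2 (ae_of_all _ fun u hu => ?_)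
      exact (integrable_cpow_mul_exp_neg_mul_Ioi h0 hu).mul_const (Complex.exp (-u))
    · have h2 : IntegrableOn (fun u : ℝ => Real.Gamma s.re * (u ^ (-s.re) * Real.exp (-1 * u)))
          (Set.Ioi 0) := by
        have := integrableOn_rpow_mul_exp_neg_mul_rpow (p := 1) (s := -s.re) (b := 1)
          (by linarith) one_pos one_pos
        refine Integrable.const_mul (this.congr_fun (fun u _ => ?_) measurableSet_Ioi) _
        simp
      refine h2.congr_fun (fun u hu => ?_) measurableSet_Ioi
      have hu' : (0 : ℝ) < u := hu
      simp only
      rw [setIntegral_congr_fun measurableSet_Ioi (fun x hx => hnorm x hx u),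
        integral_mul_const, Real.integral_rpow_mul_exp_neg_mul_Ioi h0 hu, one_div,
        Real.inv_rpow hu'.le, Real.rpow_neg hu'.le]
      simp
      ring
  have hinner : ∀ x ∈ Set.Ioi (0 : ℝ), ∫ u in Set.Ioi (0 : ℝ), F (x, u)
      = (x : ℂ) ^ (s - 1) • ((1 + x)⁻¹ : ℂ) := by
    intro x hx
    have hx' : (0 : ℝ) < 1 + x := by have : (0 : ℝ) < x := hx; linarith
    have h3 : ∀ u : ℝ, F (x, u) = (x : ℂ) ^ (s - 1) * ((Real.exp (-((1 + x) * u)) : ℝ) : ℂ) := by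
      intro u
      simp only [F]
      rw [mul_assoc, ← Complex.exp_add]
      push_cast
      ring_nf
    simp_rw [h3]
    rw [integral_const_mul, integral_complex_ofReal, integral_exp_neg_mul_Ioi hx']
    simp
  constructor
  · exact IntegrableOn.congr_fun hF.integral_prod_left hinner measurableSet_Ioi
  · rw [mellin, ← setIntegral_congr_fun measurableSet_Ioi hinner, integral_integral_swap hF]
    have h4 : ∀ u ∈ Set.Ioi (0 : ℝ), ∫ x in Set.Ioi (0 : ℝ), F (x, u)
        = Complex.Gamma s * ((u : ℂ) ^ ((1 - s) - 1) * Complex.exp (-((1 : ℝ) * u))) := by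
      intro u hu
      have hu' : (0 : ℝ) < u := hu
      simp only [F]
      rw [integral_mul_const, Complex.integral_cpow_mul_exp_neg_mul_Ioi h0 hu, one_div,
        Complex.inv_cpow _ _ (by rw [Complex.arg_ofReal_of_nonneg hu'.le]; exact Real.pi_pos.ne),
        sub_sub_cancel_left, Complex.cpow_neg]
      simp
      ring
    rw [setIntegral_congr_fun measurableSet_Ioi h4, integral_const_mul,
      Complex.integral_cpow_mul_exp_neg_mul_Ioi (by simpa using h1) one_pos]
    simp

/-- The Mellin transform of `x ↦ log (1 + x)` on its strip of convergence. -/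
lemma mellin_log_one_add {s : ℂ} (h1 : -1 < s.re) (h0 : s.re < 0) :
    mellin (fun x : ℝ => (Real.log (1 + x) : ℂ)) s
      = Complex.Gamma (1 + s) * Complex.Gamma (1 - s) / s ^ 2 := by
  have hs : s ≠ 0 := by rintro rfl; simp at h0
  have hconv := mellinConvergent_log_one_add h1 h0
  have hinv := hasMellin_inv_one_add (s := 1 + s) (by simp; linarith) (by simp; linarith)
  -- Integration by parts: the boundary values of `x^s log (1 + x)` vanish, so `s` times the
  -- transform is minus the transform of `(1 + x)⁻¹` at `1 + s`.
  have hderiv : ∀ x ∈ Set.Ioi (0 : ℝ),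
      HasDerivAt (fun x : ℝ => (x : ℂ) ^ s * (Real.log (1 + x) : ℂ))
        (s * ((x : ℂ) ^ (s - 1) • (Real.log (1 + x) : ℂ)) +
          (x : ℂ) ^ (1 + s - 1) • ((1 + x)⁻¹ : ℂ)) x := by
    intro x hx
    have hx' : (0 : ℝ) < x := hx
    have d1 : HasDerivAt (fun x : ℝ => (x : ℂ) ^ s) (s * (x : ℂ) ^ (s - 1)) x :=
      hasDerivAt_ofReal_cpow_const hx'.ne' hs
    have d2 : HasDerivAt (fun x : ℝ => (Real.log (1 + x) : ℂ)) (((1 + x)⁻¹ : ℝ) : ℂ) x := by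
      have := ((hasDerivAt_id x).const_add 1).log (by simp; linarith)
      simpa using this.ofReal_comp
    refine (d1.mul d2).congr_deriv ?_
    push_cast
    rw [add_sub_cancel_left, smul_eq_mul, smul_eq_mul]
    ring
  have hbound : ∀ {p x : ℝ}, 0 < p → p ≤ 1 → 0 < x →
      ‖(x : ℂ) ^ s * (Real.log (1 + x) : ℂ)‖ ≤ x ^ (s.re + p) / p := by
    intro p x hp hp1 hx
    rw [norm_mul, Complex.norm_cpow_eq_rpow_re_of_pos hx, Complex.norm_real,
      Real.norm_of_nonneg (Real.log_nonneg (by linarith)), Real.rpow_add hx, mul_div_assoc]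
    gcongr
    exact Real.log_one_add_le_rpow_div hx.le hp hp1
  have hzero : ContinuousWithinAt (fun x : ℝ => (x : ℂ) ^ s * (Real.log (1 + x) : ℂ))
      (Set.Ici 0) 0 := by
    rw [← continuousWithinAt_Ioi_iff_Ici, ContinuousWithinAt]
    simp only [add_zero, Real.log_one, Complex.ofReal_zero, mul_zero]
    have ht : Filter.Tendsto (fun x : ℝ => x ^ (s.re + 1) / 1) (nhdsWithin 0 (Set.Ioi 0))
        (nhds 0) := by
      have : ContinuousAt (fun x : ℝ => x ^ (s.re + 1)) 0 :=
        Real.continuousAt_rpow_const _ _ (Or.inr (by linarith))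
      have := this.tendsto.mono_left (nhdsWithin_le_nhds (s := Set.Ioi 0))
      simpa [Real.zero_rpow (by linarith : s.re + 1 ≠ 0)] using this
    refine squeeze_zero_norm' ?_ ht
    filter_upwards [self_mem_nhdsWithin] with x hx
    exact hbound one_pos le_rfl hx
  have htop : Filter.Tendsto (fun x : ℝ => (x : ℂ) ^ s * (Real.log (1 + x) : ℂ)) Filter.atTop
      (nhds 0) := by
    -- With `p = -Re s / 2` the exponent `Re s + p = Re s / 2` is still negative.
    have ht : Filter.Tendsto (fun x : ℝ => x ^ (s.re + -s.re / 2) / (-s.re / 2)) Filter.atTop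
        (nhds 0) := by
      have := (tendsto_rpow_neg_atTop (y := -s.re / 2) (by linarith)).div_const (-s.re / 2)
      rw [zero_div] at this
      refine this.congr fun x => ?_
      ring_nf
    refine squeeze_zero_norm' ?_ ht
    filter_upwards [Filter.eventually_gt_atTop 0] with x hx
    exact hbound (by linarith) (by linarith) hx
  have hsum := integral_Ioi_of_hasDerivAt_of_tendsto hzero hderiv
    ((hconv.const_mul s).add hinv.1) htop
  rw [integral_add (hconv.const_mul s) hinv.1, integral_const_mul] at hsum
  have e1 := hinv.2
  rw [mellin] at e1 ⊢
  rw [e1] at hsum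
  simp only [Complex.ofReal_zero, add_zero, Real.log_one, mul_zero, sub_zero] at hsum
  have e2 : Complex.Gamma (1 - s) = -s * Complex.Gamma (1 - (1 + s)) := by
    rw [show 1 - (1 + s) = -s by ring, ← Complex.Gamma_add_one _ (neg_ne_zero.2 hs)]
    ring_nf
  rw [e2]
  field_simp
  linear_combination hsum

/-- A vertical line of the strip `-1 < Re s < 0`, on which the Mellin transform of
`x ↦ log (1 + x)` is integrable. -/
lemma verticalIntegrable_mellin_log_one_add {σ : ℝ} (h1 : -1 < σ) (h0 : σ < 0) :
    Complex.VerticalIntegrable (mellin (fun x : ℝ => (Real.log (1 + x) : ℂ))) σ := by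
  have hre : ∀ t : ℝ, ((σ : ℂ) + t * Complex.I).re = σ := by intro t; simp
  have hne : ∀ t : ℝ, ((σ : ℂ) + t * Complex.I) ≠ 0 := by
    intro t h
    have := hre t
    rw [h] at this
    simp at this
    linarith
  have heq : (fun t : ℝ => mellin (fun x : ℝ => (Real.log (1 + x) : ℂ)) (σ + t * Complex.I))
      = fun t : ℝ => Complex.Gamma (1 + (σ + t * Complex.I)) *
        Complex.Gamma (1 - (σ + t * Complex.I)) / ((σ : ℂ) + t * Complex.I) ^ 2 := by
    ext t
    exact mellin_log_one_add (by rw [hre]; exact h1) (by rw [hre]; exact h0)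
  have hG : ∀ {a b : ℂ}, 0 < a.re → b.re = 0 →
      Continuous fun t : ℝ => Complex.Gamma (a + t * b) := by
    intro a b ha hb
    refine continuous_iff_continuousAt.2 fun t => ?_
    refine ContinuousAt.comp (g := Complex.Gamma)
      (Complex.differentiableAt_Gamma _ fun m hm => ?_).continuousAt (by fun_prop)
    have := congrArg Complex.re hm
    simp [hb] at this
    have hm0 : (0 : ℝ) ≤ m := m.cast_nonneg
    linarith
  -- The Gamma factors are merely bounded on the line; the integrable decay comes from `1 / |s|²`.
  have hbound : Integrable fun t : ℝ =>
      Real.Gamma (1 + σ) * Real.Gamma (1 - σ) * ((σ ^ 2)⁻¹ * (1 + (σ⁻¹ * t) ^ 2)⁻¹) :=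
    ((integrable_inv_one_add_sq.comp_mul_left' (inv_ne_zero h0.ne)).const_mul _).const_mul _
  rw [Complex.VerticalIntegrable, heq]
  refine hbound.mono' (Continuous.aestronglyMeasurable ?_) (ae_of_all _ fun t => ?_)
  · refine ((Continuous.mul ?_ ?_).div (by fun_prop) fun t => pow_ne_zero 2 (hne t))
    · simpa [add_assoc] using hG (a := 1 + σ) (b := Complex.I) (by simp; linarith) (by simp)
    · refine (hG (a := 1 - σ) (b := -Complex.I) (by simp; linarith) (by simp)).congr fun t => ?_
      ring_nf
  · rw [norm_div, norm_mul, norm_pow, ← Complex.normSq_eq_norm_sq, div_eq_mul_inv]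
    have e : (Complex.normSq ((σ : ℂ) + t * Complex.I))⁻¹
        = (σ ^ 2)⁻¹ * (1 + (σ⁻¹ * t) ^ 2)⁻¹ := by
      rw [Complex.normSq_add_mul_I, ← mul_inv]
      congr 1
      field_simp [h0.ne]
    have g1 := Complex.norm_Gamma_le_Gamma_re (s := 1 + (σ + t * Complex.I)) (by simp; linarith)
    have g2 := Complex.norm_Gamma_le_Gamma_re (s := 1 - (σ + t * Complex.I)) (by simp; linarith)
    have r1 : (1 + ((σ : ℂ) + t * Complex.I)).re = 1 + σ := by simp
    have r2 : (1 - ((σ : ℂ) + t * Complex.I)).re = 1 - σ := by simp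
    rw [r1] at g1
    rw [r2] at g2
    rw [e]
    have := (norm_nonneg _).trans g1
    gcongr

/-- The logarithm as a Mellin-Barnes integral. -/
lemma log_one_add_eq_integral {σ x : ℝ} (h1 : -1 < σ) (h0 : σ < 0) (hx : 0 < x) :
    (Real.log (1 + x) : ℂ) = (1 / (2 * (Real.pi : ℂ))) * ∫ t : ℝ,
      (x : ℂ) ^ (-(σ + t * Complex.I)) *
        mellin (fun x : ℝ => (Real.log (1 + x) : ℂ)) (σ + t * Complex.I) := by
  have hc : ContinuousAt (fun x : ℝ => (Real.log (1 + x) : ℂ)) x := by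
    refine Complex.continuous_ofReal.continuousAt.comp ?_
    exact ContinuousAt.log (by fun_prop) (by positivity)
  have := mellinInv_mellin_eq σ (fun x : ℝ => (Real.log (1 + x) : ℂ)) hx
    (mellinConvergent_log_one_add (by simpa using h1) (by simpa using h0))
    (verticalIntegrable_mellin_log_one_add h1 h0) hc
  rw [← this, mellinInv]
  simp only [Complex.real_smul, smul_eq_mul]
  push_cast
  rfl

/-- The Mellin-Barnes integral of `Γ(N - s)` times the Mellin transform of `log (1 + x)`, as the
Laplace transform of `x ^ (N - 1) log (1 + x)`. -/
lemma laplace_log_one_add {N : ℕ} (hN : 1 ≤ N) {σ z : ℝ} (h1 : -1 < σ) (h0 : σ < 0) (hz : 0 < z) :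
    Integrable (fun t : ℝ => mellin (fun x : ℝ => (Real.log (1 + x) : ℂ)) (σ + t * Complex.I) *
      (Complex.Gamma (N - (σ + t * Complex.I)) * (z : ℂ) ^ ((σ + t * Complex.I) - N))) ∧
    (1 / (2 * (Real.pi : ℂ))) * ∫ t : ℝ,
        mellin (fun x : ℝ => (Real.log (1 + x) : ℂ)) (σ + t * Complex.I) *
        (Complex.Gamma (N - (σ + t * Complex.I)) * (z : ℂ) ^ ((σ + t * Complex.I) - N))
      = ((∫ x in Set.Ioi (0 : ℝ), x ^ (N - 1) * Real.exp (-(z * x)) * Real.log (1 + x) : ℝ) : ℂ) := by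
  set M : ℝ → ℂ := fun t => mellin (fun x : ℝ => (Real.log (1 + x) : ℂ)) (σ + t * Complex.I) with hM
  have hN' : (1 : ℝ) ≤ N := by exact_mod_cast hN
  have hMint : Integrable M := verticalIntegrable_mellin_log_one_add h1 h0
  -- Integrating out `x` produces the Gamma factor and the power of `z`; integrating out `t` is
  -- Mellin inversion and restores the logarithm.
  let F : ℝ × ℝ → ℂ := fun p =>
    M p.2 * ((p.1 : ℂ) ^ ((N - (σ + p.2 * Complex.I)) - 1) * Complex.exp (-(z * p.1)))
  have hre : ∀ t : ℝ, ((N : ℂ) - (σ + t * Complex.I)).re = N - σ := by intro t; simp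
  have hF : Integrable F ((volume.restrict (Set.Ioi 0)).prod volume) := by
    have hreal : IntegrableOn (fun x : ℝ => x ^ ((N - σ) - 1) * Real.exp (-z * x))
        (Set.Ioi 0) := by
      simpa using integrableOn_rpow_mul_exp_neg_mul_rpow (p := 1) (s := (N - σ) - 1) (b := z)
        (by linarith) one_pos hz
    have hprod : Integrable (fun p : ℝ × ℝ => p.1 ^ ((N - σ) - 1) * Real.exp (-z * p.1) * ‖M p.2‖)
        ((volume.restrict (Set.Ioi 0)).prod volume) := Integrable.mul_prod hreal hMint.norm
    have hpos : ∀ᵐ p : ℝ × ℝ ∂((volume.restrict (Set.Ioi 0)).prod volume), 0 < p.1 := by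
      have : ∀ᵐ x ∂(volume.restrict (Set.Ioi (0 : ℝ))), 0 < x :=
        ae_restrict_mem measurableSet_Ioi
      exact Measure.quasiMeasurePreserving_fst.ae this
    refine hprod.mono' ?_ ?_
    · refine AEStronglyMeasurable.mul ?_ ?_
      · exact hMint.aestronglyMeasurable.comp_snd
      · have : (volume.restrict (Set.Ioi (0 : ℝ))).prod (volume : Measure ℝ)
            = (volume.prod volume).restrict (Set.Ioi 0 ×ˢ Set.univ) := by
          rw [← Measure.prod_restrict, Measure.restrict_univ]
        rw [this]
        refine ContinuousOn.aestronglyMeasurable ?_ (measurableSet_Ioi.prod .univ)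
        refine ContinuousOn.mul (ContinuousOn.cpow (by fun_prop) (by fun_prop) fun p hp => ?_)
          (by fun_prop)
        exact Complex.ofReal_mem_slitPlane.2 hp.1
    · filter_upwards [hpos] with p hp
      simp only [F]
      rw [norm_mul, norm_mul, Complex.norm_cpow_eq_rpow_re_of_pos hp, Complex.norm_exp,
        Complex.sub_re, hre]
      simp [mul_comm]
  have hin : ∀ t : ℝ, ∫ x in Set.Ioi (0 : ℝ), F (x, t)
      = M t * (Complex.Gamma (N - (σ + t * Complex.I)) * (z : ℂ) ^ ((σ + t * Complex.I) - N)) := by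
    intro t
    simp only [F]
    rw [integral_const_mul, Complex.integral_cpow_mul_exp_neg_mul_Ioi
      (by rw [hre]; linarith) hz, one_div, Complex.inv_cpow _ _
      (by rw [Complex.arg_ofReal_of_nonneg hz.le]; exact Real.pi_pos.ne), ← Complex.cpow_neg,
      neg_sub, mul_comm (Complex.Gamma _)]
  have hout : ∀ x ∈ Set.Ioi (0 : ℝ), (1 / (2 * (Real.pi : ℂ))) * ∫ t : ℝ, F (x, t)
      = ((x ^ (N - 1) * Real.exp (-(z * x)) * Real.log (1 + x) : ℝ) : ℂ) := by
    intro x hx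
    have hx' : (0 : ℝ) < x := hx
    have hxc : (x : ℂ) ≠ 0 := Complex.ofReal_ne_zero.2 hx'.ne'
    have e : ∀ t : ℝ, F (x, t) = ((x : ℂ) ^ (N - 1) * Complex.exp (-(z * x))) *
        ((x : ℂ) ^ (-(σ + t * Complex.I)) * M t) := by
      intro t
      simp only [F]
      rw [show (N : ℂ) - (σ + t * Complex.I) - 1 = ((N - 1 : ℕ) : ℂ) + -(σ + t * Complex.I) by
        push_cast [Nat.cast_sub hN]; ring, Complex.cpow_add _ _ hxc, Complex.cpow_natCast]
      ring
    simp_rw [e]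
    rw [integral_const_mul]
    push_cast
    rw [show ∀ A B C : ℂ, A * (B * C) = B * (A * C) by intros; ring,
      ← log_one_add_eq_integral h1 h0 hx']
  constructor
  · have := hF.integral_prod_right
    simpa only [hin] using this
  · rw [← integral_complex_ofReal, ← setIntegral_congr_fun measurableSet_Ioi hout,
      integral_const_mul, integral_integral_swap hF]
    simp_rw [hin, hM]

/-! ### The Meijer function as a Laplace transform. -/

/-- The Mellin-Barnes integrand on a separating line. -/
lemma meijerGIntegrand_rate {N : ℕ} {c z : ℝ} (h1 : -(N : ℝ) - 1 < c) (h0 : c < -(N : ℝ))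
    (t : ℝ) :
    meijerGIntegrand 3 1 (rateUpper N) (rateLower N) (z : ℂ) ((c : ℂ) + (t : ℂ) * Complex.I)
      = mellin (fun x : ℝ => (Real.log (1 + x) : ℂ)) (((N + c : ℝ) : ℂ) + t * Complex.I) *
        (Complex.Gamma (N - (((N + c : ℝ) : ℂ) + t * Complex.I)) *
          (z : ℂ) ^ ((((N + c : ℝ) : ℂ) + t * Complex.I) - N)) := by
  set s : ℂ := ((N + c : ℝ) : ℂ) + t * Complex.I with hs
  have hre : s.re = N + c := by simp [hs]
  have hsc : (c : ℂ) + t * Complex.I = s - N := by rw [hs]; push_cast; ring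
  have hs0 : s ≠ 0 := by
    intro h
    rw [h, Complex.zero_re] at hre
    linarith
  rw [mellin_log_one_add (by rw [hre]; linarith) (by rw [hre]; linarith), hsc, meijerGIntegrand]
  simp only [Fin.prod_univ_three, Fin.prod_univ_two, rateUpper, rateLower]
  -- This turns `Γ(1-s) / s²` into `Γ(-s)² / Γ(1-s)`, the form in Meijer's integrand.
  have hG : Complex.Gamma (1 - s) = -s * Complex.Gamma (-s) := by
    rw [← Complex.Gamma_add_one _ (neg_ne_zero.2 hs0)]
    ring_nf
  have hG0 : Complex.Gamma (-s) ≠ 0 :=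
    Complex.Gamma_ne_zero_of_re_pos (by rw [Complex.neg_re, hre]; linarith)
  simp
  rw [show -(N : ℂ) - (s - N) = -s by ring, hG]
  field_simp

lemma isMeijerGLine_rate_iff {N : ℕ} {c : ℝ} :
    IsMeijerGLine 3 1 (rateUpper N) (rateLower N) c ↔ -(N : ℝ) - 1 < c ∧ c < -(N : ℝ) := by
  have hN : (0 : ℝ) ≤ N := N.cast_nonneg
  simp [IsMeijerGLine, rateUpper, rateLower, Fin.forall_fin_succ]
  constructor
  · rintro ⟨⟨-, h⟩, h'⟩
    exact ⟨h', h⟩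
  · rintro ⟨h', h⟩
    exact ⟨⟨by linarith, h⟩, h'⟩

/-- The value does not mention `c`, so independence of the line needs no contour shift, and the line
picked by choice in `meijerG` is harmless. -/
lemma meijerGLineIntegral_rate {N : ℕ} (hN : 1 ≤ N) {c z : ℝ}
    (hc : IsMeijerGLine 3 1 (rateUpper N) (rateLower N) c) (hz : 0 < z) :
    Integrable (fun t : ℝ => meijerGIntegrand 3 1 (rateUpper N) (rateLower N) (z : ℂ)
      ((c : ℂ) + (t : ℂ) * Complex.I)) ∧
    meijerGLineIntegral 3 1 (rateUpper N) (rateLower N) (z : ℂ) c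
      = ((∫ x in Set.Ioi (0 : ℝ), x ^ (N - 1) * Real.exp (-(z * x)) * Real.log (1 + x) : ℝ) : ℂ) := by
  obtain ⟨h1, h0⟩ := isMeijerGLine_rate_iff.1 hc
  have := laplace_log_one_add hN (σ := N + c) (by linarith) (by linarith) hz
  simp_rw [meijerGLineIntegral, meijerGIntegrand_rate h1 h0]
  exact this

lemma exists_isMeijerGLine_rate (N : ℕ) :
    ∃ c : ℝ, IsMeijerGLine 3 1 (rateUpper N) (rateLower N) c :=
  ⟨-(N : ℝ) - 1 / 2, isMeijerGLine_rate_iff.2 ⟨by linarith, by linarith⟩⟩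

lemma rateG_eq_integral {N : ℕ} (hN : 1 ≤ N) {z : ℝ} (hz : 0 < z) :
    rateG N z
      = ((∫ x in Set.Ioi (0 : ℝ), x ^ (N - 1) * Real.exp (-(z * x)) * Real.log (1 + x) : ℝ) : ℂ) := by
  have h := exists_isMeijerGLine_rate N
  rw [rateG, meijerG, dif_pos h]
  exact (meijerGLineIntegral_rate hN h.choose_spec hz).2

lemma meijerGWellDefined_rate {N : ℕ} (hN : 1 ≤ N) {z : ℝ} (hz : 0 < z) :
    MeijerGWellDefined 3 1 (rateUpper N) (rateLower N) (z : ℂ) := by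
  refine ⟨exists_isMeijerGLine_rate N, fun c hc => ?_⟩
  obtain ⟨hi, he⟩ := meijerGLineIntegral_rate hN hc hz
  exact ⟨hi, he.trans (rateG_eq_integral hN hz).symm⟩

/-! ### Gamma laws of integral shape and their moment generating functions. -/

lemma gammaMeasure_natCast_eq_withDensity {N : ℕ} (hN : 1 ≤ N) (r : ℝ) :
    gammaMeasure N r = (volume.restrict (Set.Ioi 0)).withDensity
      (fun x => ENNReal.ofReal (r ^ N / Real.Gamma N * x ^ (N - 1) * Real.exp (-(r * x)))) := by
  rw [gammaMeasure, ← withDensity_indicator measurableSet_Ioi]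
  refine withDensity_congr_ae ?_
  have h0 : ∀ᵐ x : ℝ, x ≠ 0 := by simp [ae_iff]
  filter_upwards [h0] with x hx
  rcases lt_or_gt_of_ne hx with h | h
  · rw [gammaPDF_of_neg h, Set.indicator_of_notMem (by simpa using h.le)]
  · rw [gammaPDF_of_nonneg h.le, Set.indicator_of_mem (by simpa using h), Real.rpow_natCast,
      ← Nat.cast_one, ← Nat.cast_sub hN, Real.rpow_natCast]

lemma gammaDensity_nonneg (N : ℕ) {r x : ℝ} (hr : 0 < r) (hx : 0 < x) :
    0 ≤ r ^ N / Real.Gamma N * x ^ (N - 1) * Real.exp (-(r * x)) := by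
  have : 0 ≤ Real.Gamma N := Real.Gamma_nonneg_of_nonneg N.cast_nonneg
  positivity

lemma integral_gammaMeasure {N : ℕ} (hN : 1 ≤ N) {r : ℝ} (hr : 0 < r) (f : ℝ → ℝ) :
    ∫ x, f x ∂(gammaMeasure N r) = ∫ x in Set.Ioi (0 : ℝ),
      r ^ N / Real.Gamma N * x ^ (N - 1) * Real.exp (-(r * x)) * f x := by
  rw [gammaMeasure_natCast_eq_withDensity hN, integral_withDensity_eq_integral_toReal_smul
    (by fun_prop) (by simp)]
  refine setIntegral_congr_fun measurableSet_Ioi fun x hx => ?_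
  simp only [smul_eq_mul]
  rw [ENNReal.toReal_ofReal (gammaDensity_nonneg N hr hx)]

lemma integrable_gammaMeasure_iff {N : ℕ} (hN : 1 ≤ N) {r : ℝ} (hr : 0 < r) (f : ℝ → ℝ) :
    Integrable f (gammaMeasure N r) ↔ IntegrableOn (fun x : ℝ =>
      r ^ N / Real.Gamma N * x ^ (N - 1) * Real.exp (-(r * x)) * f x) (Set.Ioi 0) := by
  rw [gammaMeasure_natCast_eq_withDensity hN, integrable_withDensity_iff_integrable_smul'
    (by fun_prop) (by simp)]
  refine integrable_congr ((ae_restrict_iff' measurableSet_Ioi).2 (ae_of_all _ fun x hx => ?_))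
  simp only [smul_eq_mul]
  rw [ENNReal.toReal_ofReal (gammaDensity_nonneg N hr hx)]

lemma ae_pos_gammaMeasure {N : ℕ} (hN : 1 ≤ N) (r : ℝ) : ∀ᵐ x ∂(gammaMeasure N r), 0 < x := by
  rw [gammaMeasure_natCast_eq_withDensity hN]
  exact (withDensity_absolutelyContinuous _ _).ae_le (ae_restrict_mem measurableSet_Ioi)

lemma integrableOn_pow_mul_exp_neg_mul (n : ℕ) {b : ℝ} (hb : 0 < b) :
    IntegrableOn (fun x : ℝ => x ^ n * Real.exp (-(b * x))) (Set.Ioi 0) := by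
  have := integrableOn_rpow_mul_exp_neg_mul_rpow (p := 1) (s := n) (b := b)
    (by have : (0 : ℝ) ≤ n := n.cast_nonneg
        linarith) one_pos hb
  simpa using this

/-- The integrand dominates `x ^ n`. This settles where a Gamma moment generating function falls
back to its default value `0`. -/
lemma not_integrableOn_pow_mul_exp (n : ℕ) {b : ℝ} (hb : 0 ≤ b) :
    ¬ IntegrableOn (fun x : ℝ => x ^ n * Real.exp (b * x)) (Set.Ioi 0) := by
  intro h
  refine not_integrableOn_Ioi_rpow (n : ℝ) (h.mono' (by fun_prop) ?_)
  refine (ae_restrict_iff' measurableSet_Ioi).2 (ae_of_all _ fun x hx => ?_)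
  have hx' : (0 : ℝ) < x := hx
  rw [Real.rpow_natCast, Real.norm_of_nonneg (by positivity)]
  exact le_mul_of_one_le_right (by positivity) (Real.one_le_exp (by positivity))

lemma integral_pow_mul_exp_neg_mul {N : ℕ} (hN : 1 ≤ N) {b : ℝ} (hb : 0 < b) :
    ∫ x in Set.Ioi (0 : ℝ), x ^ (N - 1) * Real.exp (-(b * x)) = Real.Gamma N / b ^ N := by
  have h := Real.integral_rpow_mul_exp_neg_mul_Ioi (a := N) (by exact_mod_cast hN) hb
  rw [← Nat.cast_one, ← Nat.cast_sub hN] at h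
  simp only [Real.rpow_natCast] at h
  rw [h, Nat.cast_one, one_div, inv_pow]
  ring

lemma integrable_exp_mul_gammaMeasure_iff {N : ℕ} (hN : 1 ≤ N) {r : ℝ} (hr : 0 < r) (t : ℝ) :
    Integrable (fun x => Real.exp (t * x)) (gammaMeasure N r) ↔ t < r := by
  have hG : 0 < Real.Gamma N := Real.Gamma_pos_of_pos (by exact_mod_cast hN)
  rw [integrable_gammaMeasure_iff hN hr]
  have e : (fun x : ℝ => r ^ N / Real.Gamma N * x ^ (N - 1) * Real.exp (-(r * x)) *
      Real.exp (t * x)) = fun x : ℝ => r ^ N / Real.Gamma N *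
        (x ^ (N - 1) * Real.exp (-((r - t) * x))) := by
    ext x
    rw [mul_assoc, ← Real.exp_add]
    ring_nf
  rw [e]
  constructor
  · intro h
    by_contra! hlt
    refine not_integrableOn_pow_mul_exp (N - 1) (b := t - r) (by linarith) ?_
    have h2 := Integrable.const_mul h (r ^ N / Real.Gamma N)⁻¹
    refine h2.congr (ae_of_all _ fun x => ?_)
    simp only
    rw [inv_mul_cancel_left₀ (by positivity)]
    ring_nf
  · intro h
    exact Integrable.const_mul (integrableOn_pow_mul_exp_neg_mul (N - 1) (by linarith)) _

/-- The moment generating function of a Gamma law of integral shape, with the value `0` where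
it is undefined. -/
lemma mgf_gammaMeasure {N : ℕ} (hN : 1 ≤ N) {r : ℝ} (hr : 0 < r) (t : ℝ) :
    mgf id (gammaMeasure N r) t = (if t < r then r / (r - t) else 0) ^ N := by
  have hG : 0 < Real.Gamma N := Real.Gamma_pos_of_pos (by exact_mod_cast hN)
  split_ifs with h
  · rw [mgf, integral_gammaMeasure hN hr]
    have e : ∀ x : ℝ, r ^ N / Real.Gamma N * x ^ (N - 1) * Real.exp (-(r * x)) *
        Real.exp (t * id x) = r ^ N / Real.Gamma N *
          (x ^ (N - 1) * Real.exp (-((r - t) * x))) := by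
      intro x
      rw [mul_assoc, ← Real.exp_add, id]
      ring_nf
    simp_rw [e]
    rw [integral_const_mul, integral_pow_mul_exp_neg_mul hN (by linarith), div_pow]
    field_simp
  -- `N ≥ 1` makes `0 ^ N = 0`, the default value of a divergent integral.
  · rw [zero_pow (by omega)]
    exact integral_undef fun hi => h ((integrable_exp_mul_gammaMeasure_iff hN hr t).1 hi)

lemma zero_mem_interior_integrableExpSet_gammaMeasure {N : ℕ} (hN : 1 ≤ N) {r : ℝ} (hr : 0 < r) :
    (0 : ℝ) ∈ interior (integrableExpSet id (gammaMeasure N r)) := by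
  refine mem_interior.2 ⟨Set.Iio r, fun t ht => ?_, isOpen_Iio, hr⟩
  exact (integrable_exp_mul_gammaMeasure_iff hN hr t).2 ht

/-- A Gamma law of integral shape is determined by its moment generating function. -/
lemma hasLaw_gammaMeasure_of_mgf {S : Type*} [MeasurableSpace S] {μ : Measure S}
    [IsProbabilityMeasure μ] {X : S → ℝ} (hX : AEMeasurable X μ) {N : ℕ} (hN : 1 ≤ N) {r : ℝ}
    (hr : 0 < r) (h : ∀ t, mgf X μ t = (if t < r then r / (r - t) else 0) ^ N) :
    HasLaw X (gammaMeasure N r) μ := by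
  have : IsProbabilityMeasure (gammaMeasure N r) :=
    isProbabilityMeasure_gammaMeasure (by exact_mod_cast hN) hr
  have : IsProbabilityMeasure (μ.map X) := Measure.isProbabilityMeasure_map hX
  refine ⟨hX, (Measure.ext_of_charFun ?_).symm⟩
  ext t
  rw [← complexMGF_mul_I hX, ← complexMGF_id_mul_I]
  -- The characteristic function is the complex MGF on the imaginary axis. Real MGFs that agree near
  -- `0` determine it there by analytic continuation.
  refine eqOn_complexMGF_of_mgf (μ := gammaMeasure N r) ?_ ?_
  · ext t
    rw [mgf_gammaMeasure hN hr, h]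
  · simpa using zero_mem_interior_integrableExpSet_gammaMeasure hN hr

/-! ### From complex normal channels to Gamma gains. -/

/-- No bound on `t` is needed: for `t ≥ 1 / v` the integral diverges and the root on the right is
`0` by convention. -/
lemma mgf_sq_gaussianReal {v : ℝ} (hv : 0 < v) (t : ℝ) :
    ∫ x, Real.exp (t * x ^ 2) ∂(gaussianReal 0 (v / 2).toNNReal)
      = (√(Real.pi * v))⁻¹ * √(Real.pi / (1 / v - t)) := by
  have hv2 : (v / 2).toNNReal ≠ 0 := by simpa using hv
  rw [integral_gaussianReal_eq_integral_smul hv2, ← integral_gaussian, ← integral_const_mul]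
  refine integral_congr_ae (ae_of_all _ fun x => ?_)
  simp only [gaussianPDFReal_def, smul_eq_mul, Real.coe_toNNReal (v / 2) (by positivity)]
  rw [mul_assoc, ← Real.exp_add, show 2 * Real.pi * (v / 2) = Real.pi * v by ring]
  congr 2
  field_simp
  ring

/-- The squared modulus of a circularly symmetric complex normal variable has the moment
generating function of an exponential law. -/
lemma mgf_normSq_complexNormal {v : ℝ} (hv : 0 < v) (t : ℝ) :
    mgf (fun z : ℂ => ‖z‖ ^ 2) (complexNormal v) t
      = if t < 1 / v then (1 / v) / (1 / v - t) else 0 := by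
  rw [mgf, complexNormal, integral_map (by fun_prop) (by fun_prop)]
  have e : ∀ p : ℝ × ℝ, Real.exp (t * ‖Complex.measurableEquivRealProd.symm p‖ ^ 2)
      = Real.exp (t * p.1 ^ 2) * Real.exp (t * p.2 ^ 2) := by
    intro p
    rw [← Real.exp_add, ← Complex.normSq_eq_norm_sq, Complex.normSq_apply]
    simp [Complex.measurableEquivRealProd]
    ring
  simp_rw [e]
  rw [integral_prod_mul (fun x : ℝ => Real.exp (t * x ^ 2)) (fun x : ℝ => Real.exp (t * x ^ 2)),
    mgf_sq_gaussianReal hv]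
  split_ifs with h
  · have h1 : 0 < 1 / v - t := by linarith
    rw [mul_mul_mul_comm, ← mul_inv, Real.mul_self_sqrt (by positivity),
      Real.mul_self_sqrt (by positivity)]
    field_simp [Real.pi_ne_zero]
  · rw [Real.sqrt_eq_zero_of_nonpos (x := Real.pi / (1 / v - t))]
    · simp
    · exact div_nonpos_of_nonneg_of_nonpos Real.pi_pos.le (by linarith)

lemma mgf_normSq_of_hasLaw {S : Type*} [MeasurableSpace S] {μ : Measure S} {X : S → ℂ} {v : ℝ}
    (hv : 0 < v) (hX : HasLaw X (complexNormal v) μ) (t : ℝ) :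
    mgf (fun ω => ‖X ω‖ ^ 2) μ t = if t < 1 / v then (1 / v) / (1 / v - t) else 0 := by
  rw [← mgf_normSq_complexNormal hv t, ← hX.map_eq, mgf_map hX.aemeasurable (by fun_prop)]
  rfl

lemma hasLaw_normSq {S : Type*} [MeasurableSpace S] {μ : Measure S} [IsProbabilityMeasure μ]
    {X : S → ℂ} {v : ℝ} (hv : 0 < v) (hX : HasLaw X (complexNormal v) μ) :
    HasLaw (fun ω => ‖X ω‖ ^ 2) (gammaMeasure (1 : ℕ) (1 / v)) μ := by
  have := hX.aemeasurable
  refine hasLaw_gammaMeasure_of_mgf (by fun_prop) le_rfl (by positivity) fun t => ?_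
  rw [mgf_normSq_of_hasLaw hv hX, pow_one]

/-- The gain after maximal-ratio combining over independent Rayleigh channels is Gamma
distributed. -/
lemma hasLaw_mrcGain {S : Type*} [MeasurableSpace S] {μ : Measure S} [IsProbabilityMeasure μ]
    {N : ℕ} (hN : 1 ≤ N) {h : Fin N → S → ℂ} {v : ℝ} (hv : 0 < v)
    (hlaw : ∀ i, HasLaw (h i) (complexNormal v) μ) (hind : iIndepFun h μ) :
    HasLaw (mrcGain h) (gammaMeasure N (1 / v)) μ := by
  have hm : ∀ i, AEMeasurable (h i) μ := fun i => (hlaw i).aemeasurable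
  have hm2 : ∀ i, AEMeasurable (fun ω => ‖h i ω‖ ^ 2) μ := fun i => by
    have := hm i
    fun_prop
  have hsum : mrcGain h = ∑ i, fun ω => ‖h i ω‖ ^ 2 := by
    ext ω
    simp [mrcGain]
  have hind2 : iIndepFun (fun i ω => ‖h i ω‖ ^ 2) μ :=
    hind.comp (fun _ z => ‖z‖ ^ 2) fun _ => by fun_prop
  refine hasLaw_gammaMeasure_of_mgf ?_ hN (by positivity) fun t => ?_
  · rw [hsum]
    exact Finset.aemeasurable_sum _ fun i _ => hm2 i
  -- The product of `N` equal exponential MGFs is the `N`-th power, including where the value is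
  -- `0`.
  · rw [hsum, hind2.mgf_sum₀ hm2, Finset.prod_congr rfl fun i _ =>
      mgf_normSq_of_hasLaw hv (hlaw i) t, Finset.prod_const, Finset.card_univ, Fintype.card_fin]

/-- The two gains are functions of disjoint blocks of one independent family. -/
lemma indepFun_mrcGain {S : Type*} [MeasurableSpace S] {μ : Measure S}
    {N M : ℕ} {h : Fin N → S → ℂ} {h' : Fin M → S → ℂ}
    (hm : ∀ i, AEMeasurable (h i) μ) (hm' : ∀ i, AEMeasurable (h' i) μ)
    (hind : iIndepFun (Sum.elim h h') μ) : IndepFun (mrcGain h) (mrcGain h') μ := by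
  have hdisj : Disjoint (Finset.univ.map (Function.Embedding.inl : Fin N ↪ Fin N ⊕ Fin M))
      (Finset.univ.map (Function.Embedding.inr : Fin M ↪ Fin N ⊕ Fin M)) := by
    rw [Finset.disjoint_left]
    simp
  have := hind.indepFun_finset₀ _ _ hdisj (by rintro (i | i) <;> simp [hm, hm'])
  refine this.comp
    (φ := fun z : (Finset.univ.map (Function.Embedding.inl : Fin N ↪ Fin N ⊕ Fin M)) → ℂ =>
      ∑ i : Fin N, ‖z ⟨Sum.inl i, by simp⟩‖ ^ 2)
    (ψ := fun z : (Finset.univ.map (Function.Embedding.inr : Fin M ↪ Fin N ⊕ Fin M)) → ℂ =>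
      ∑ i : Fin M, ‖z ⟨Sum.inr i, by simp⟩‖ ^ 2)
    (by fun_prop) (by fun_prop)

/-! ### Gamma tails and the minimum of two independent variables. -/

/-- The derivative telescopes: differentiating the power in each new term cancels the density left
by the previous ones. -/
lemma hasDerivAt_erlang_tail (n : ℕ) (r x : ℝ) :
    HasDerivAt (fun y : ℝ => -(Real.exp (-(r * y)) *
        ∑ k ∈ Finset.range (n + 1), (r * y) ^ k / (Nat.factorial k : ℝ)))
      (r ^ (n + 1) / (Nat.factorial n : ℝ) * x ^ n * Real.exp (-(r * x))) x := by
  have hlin : HasDerivAt (fun y : ℝ => r * y) r x := by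
    simpa using (hasDerivAt_id x).const_mul r
  have hexp : HasDerivAt (fun y : ℝ => Real.exp (-(r * y))) (Real.exp (-(r * x)) * -r) x :=
    hlin.neg.exp
  induction n with
  | zero =>
    simp only [zero_add, Finset.range_one, Finset.sum_singleton, pow_zero, Nat.factorial_zero,
      Nat.cast_one, div_one, mul_one, pow_one]
    refine hexp.neg.congr_deriv (by ring)
  | succ n ih =>
    simp_rw [Finset.sum_range_succ _ (n + 1), mul_add, neg_add]
    have hpow : HasDerivAt (fun y : ℝ => (r * y) ^ (n + 1) / (Nat.factorial (n + 1) : ℝ))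
        (((n + 1 : ℕ) : ℝ) * (r * x) ^ n * r / (Nat.factorial (n + 1) : ℝ)) x := by
      simpa using (hlin.pow (n + 1)).div_const _
    refine (ih.add (hexp.mul hpow).neg).congr_deriv ?_
    rw [Nat.factorial_succ]
    push_cast
    have : (Nat.factorial n : ℝ) ≠ 0 := by positivity
    have : (n : ℝ) + 1 ≠ 0 := by positivity
    field_simp
    ring

/-- The tail of a Gamma law of integral shape. -/
lemma gammaMeasure_real_Ioi {N : ℕ} (hN : 1 ≤ N) {r x : ℝ} (hr : 0 < r) (hx : 0 ≤ x) :
    (gammaMeasure N r).real (Set.Ioi x)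
      = Real.exp (-(r * x)) * ∑ k ∈ Finset.range N, (r * x) ^ k / (Nat.factorial k : ℝ) := by
  obtain ⟨n, rfl⟩ : ∃ n, N = n + 1 := ⟨N - 1, by omega⟩
  have hint : IntegrableOn (fun y : ℝ => r ^ (n + 1) / (Nat.factorial n : ℝ) * y ^ n *
      Real.exp (-(r * y))) (Set.Ioi x) := by
    have := (integrableOn_pow_mul_exp_neg_mul n hr).const_mul (r ^ (n + 1) / (Nat.factorial n : ℝ))
    refine (IntegrableOn.mono_set this (Set.Ioi_subset_Ioi hx)).congr_fun (fun y _ => ?_)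
      measurableSet_Ioi
    ring
  have htend : Filter.Tendsto (fun y : ℝ => -(Real.exp (-(r * y)) *
      ∑ k ∈ Finset.range (n + 1), (r * y) ^ k / (Nat.factorial k : ℝ))) Filter.atTop (nhds 0) := by
    rw [← neg_zero]
    refine Filter.Tendsto.neg ?_
    have h1 : Filter.Tendsto (fun y : ℝ => ∑ k ∈ Finset.range (n + 1),
        (y ^ k * Real.exp (-y)) / (Nat.factorial k : ℝ)) Filter.atTop (nhds 0) := by
      rw [← Finset.sum_const_zero (s := Finset.range (n + 1))]
      refine tendsto_finsetSum _ fun k _ => ?_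
      simpa using (Real.tendsto_pow_mul_exp_neg_atTop_nhds_zero k).div_const (Nat.factorial k : ℝ)
    refine (h1.comp (Filter.tendsto_id.const_mul_atTop hr)).congr fun y => ?_
    simp only [Function.comp, id]
    rw [Finset.mul_sum]
    refine Finset.sum_congr rfl fun k _ => ?_
    ring
  have hFTC := integral_Ioi_of_hasDerivAt_of_tendsto'
    (fun y _ => hasDerivAt_erlang_tail n r y) hint htend
  rw [zero_sub, neg_neg] at hFTC
  rw [← hFTC, ← integral_indicator_one measurableSet_Ioi, integral_gammaMeasure hN hr]
  rw [← integral_indicator measurableSet_Ioi, ← integral_indicator measurableSet_Ioi]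
  refine integral_congr_ae (ae_of_all _ fun y => ?_)
  by_cases hy : x < y
  · simp [Set.indicator, hy, hx.trans_lt hy, Real.Gamma_nat_eq_factorial]
  · simp [Set.indicator, hy]

lemma integrable_id_gammaMeasure {N : ℕ} (hN : 1 ≤ N) {r : ℝ} (hr : 0 < r) :
    Integrable (fun x => x) (gammaMeasure N r) :=
  integrable_of_mem_interior_integrableExpSet
    (zero_mem_interior_integrableExpSet_gammaMeasure hN hr)

lemma integrable_log_one_add_gammaMeasure {N : ℕ} (hN : 1 ≤ N) {r b : ℝ} (hr : 0 < r)
    (hb : 0 ≤ b) : Integrable (fun x => Real.log (1 + b * x)) (gammaMeasure N r) := by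
  refine ((integrable_id_gammaMeasure hN hr).const_mul b).mono'
    (Measurable.aestronglyMeasurable (by fun_prop)) ?_
  filter_upwards [ae_pos_gammaMeasure hN r] with x hx
  rw [Real.norm_of_nonneg (Real.log_nonneg (by nlinarith))]
  have : 0 ≤ b * x := by positivity
  linarith [Real.log_le_sub_one_of_pos (show 0 < 1 + b * x by linarith)]

/-- The expectation of a function of the minimum of two independent variables. -/
lemma integral_comp_min_prod {α β : Measure ℝ} [IsProbabilityMeasure α] [IsProbabilityMeasure β]
    {φ : ℝ → ℝ} (hα : Integrable φ α) (hβ : Integrable φ β) :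
    Integrable (fun p : ℝ × ℝ => φ (min p.1 p.2)) (α.prod β) ∧
    ∫ p, φ (min p.1 p.2) ∂(α.prod β)
      = (∫ x, β.real (Set.Ioi x) * φ x ∂α) + ∫ y, α.real (Set.Ici y) * φ y ∂β := by
  have hA : MeasurableSet {p : ℝ × ℝ | p.1 < p.2} := measurableSet_lt measurable_fst measurable_snd
  have hB : MeasurableSet {p : ℝ × ℝ | p.2 ≤ p.1} := measurableSet_le measurable_snd measurable_fst
  have iA : Integrable ({p : ℝ × ℝ | p.1 < p.2}.indicator fun p => φ p.1) (α.prod β) :=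
    (hα.comp_fst β).indicator hA
  have iB : Integrable ({p : ℝ × ℝ | p.2 ≤ p.1}.indicator fun p => φ p.2) (α.prod β) :=
    (hβ.comp_snd α).indicator hB
  -- One inequality is strict and the other weak, so ties count once; hence `Ioi` in one tail and
  -- `Ici` in the other.
  have e : (fun p : ℝ × ℝ => φ (min p.1 p.2)) =
      fun p => {p : ℝ × ℝ | p.1 < p.2}.indicator (fun p => φ p.1) p +
        {p : ℝ × ℝ | p.2 ≤ p.1}.indicator (fun p => φ p.2) p := by
    ext p
    rcases lt_or_ge p.1 p.2 with h | h
    · simp [Set.indicator, h, h.not_ge, min_eq_left h.le]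
    · simp [Set.indicator, h, h.not_gt]
  rw [e]
  refine ⟨iA.add iB, ?_⟩
  rw [integral_add iA iB, integral_prod _ iA, integral_prod_symm _ iB]
  congr 1
  · refine integral_congr_ae (ae_of_all _ fun x => ?_)
    have : ∀ y, {p : ℝ × ℝ | p.1 < p.2}.indicator (fun p => φ p.1) (x, y)
        = (Set.Ioi x).indicator (fun _ => φ x) y := fun y => by simp [Set.indicator]
    simp only [this]
    rw [integral_indicator_const _ measurableSet_Ioi, smul_eq_mul]
  · refine integral_congr_ae (ae_of_all _ fun y => ?_)
    have : ∀ x, {p : ℝ × ℝ | p.2 ≤ p.1}.indicator (fun p => φ p.2) (x, y)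
        = (Set.Ici y).indicator (fun _ => φ y) x := fun x => by simp [Set.indicator]
    simp only [this]
    rw [integral_indicator_const _ measurableSet_Ici, smul_eq_mul]

/-- Gamma laws have no atoms, so the treatment of ties is immaterial. -/
lemma gammaMeasure_real_Ici (a r x : ℝ) :
    (gammaMeasure a r).real (Set.Ici x) = (gammaMeasure a r).real (Set.Ioi x) := by
  refine measureReal_congr (Ioi_ae_eq_Ici' ?_).symm
  exact withDensity_absolutelyContinuous _ _ (by simp)

/-! ### Logarithmic integrals against Gamma laws. -/

/-- The Laplace transform of `x ^ (N - 1) log (1 + x)`. -/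
noncomputable def logLaplace (N : ℕ) (z : ℝ) : ℝ :=
  ∫ x in Set.Ioi (0 : ℝ), x ^ (N - 1) * Real.exp (-(z * x)) * Real.log (1 + x)

lemma integral_pow_mul_exp_mul_log {N : ℕ} (hN : 1 ≤ N) {q b : ℝ} (hb : 0 < b) :
    ∫ x in Set.Ioi (0 : ℝ), x ^ (N - 1) * Real.exp (-(q * x)) * Real.log (1 + b * x)
      = 1 / b ^ N * logLaplace N (q / b) := by
  have h := integral_comp_mul_left_Ioi
    (fun x => x ^ (N - 1) * Real.exp (-(q / b * x)) * Real.log (1 + x)) 0 hb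
  rw [mul_zero, smul_eq_mul] at h
  rw [logLaplace]
  have e : ∀ x : ℝ, (b * x) ^ (N - 1) * Real.exp (-(q / b * (b * x))) * Real.log (1 + b * x)
      = b ^ (N - 1) * (x ^ (N - 1) * Real.exp (-(q * x)) * Real.log (1 + b * x)) := by
    intro x
    rw [show q / b * (b * x) = q * x by field_simp]
    ring
  simp_rw [e] at h
  rw [integral_const_mul] at h
  obtain ⟨n, rfl⟩ : ∃ n, N = n + 1 := ⟨N - 1, by omega⟩
  rw [Nat.add_sub_cancel] at h ⊢
  rw [eq_inv_mul_iff_mul_eq₀ hb.ne'] at h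
  rw [← h]
  have cancel : ∀ A : ℝ, A = 1 / b ^ (n + 1) * (b * (b ^ n * A)) := fun A => by
    rw [pow_succ]
    field_simp
  exact cancel _

lemma integral_log_gammaMeasure {N : ℕ} (hN : 1 ≤ N) {v b : ℝ} (hv : 0 < v) (hb : 0 < b) :
    ∫ x, Real.log (1 + b * x) ∂(gammaMeasure N (1 / v))
      = 1 / (Real.Gamma N * v ^ N * b ^ N) * logLaplace N (1 / (v * b)) := by
  rw [integral_gammaMeasure hN (by positivity)]
  simp_rw [mul_assoc ((1 / v) ^ N / Real.Gamma N)]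
  rw [integral_const_mul, integral_pow_mul_exp_mul_log hN hb, div_div, one_div_pow]
  ring

lemma integrableOn_pow_mul_exp_mul_log {N : ℕ} (hN : 1 ≤ N) {q b : ℝ} (hq : 0 < q) (hb : 0 ≤ b) :
    IntegrableOn (fun x : ℝ => x ^ (N - 1) * Real.exp (-(q * x)) * Real.log (1 + b * x))
      (Set.Ioi 0) := by
  have hG : 0 < Real.Gamma N := Real.Gamma_pos_of_pos (by exact_mod_cast hN)
  have h := (integrable_gammaMeasure_iff hN hq _).1 (integrable_log_one_add_gammaMeasure hN hq hb)
  refine IntegrableOn.congr_fun (Integrable.const_mul h (q ^ N / Real.Gamma N)⁻¹) (fun x _ => ?_)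
    measurableSet_Ioi
  field_simp

/-- The tail contributes `e^(-x/w)` and powers `x^k`. The rates add to `1/v + 1/w`, the reciprocal
of `v w / (v + w)`, and the power becomes `N + k - 1`. -/
lemma integral_tail_mul_log_gammaMeasure {N M : ℕ} (hN : 1 ≤ N) (hM : 1 ≤ M) {v w b : ℝ}
    (hv : 0 < v) (hw : 0 < w) (hb : 0 < b) :
    ∫ x, (gammaMeasure M (1 / w)).real (Set.Ioi x) * Real.log (1 + b * x) ∂(gammaMeasure N (1 / v))
      = 1 / (Real.Gamma N * v ^ N) * ∑ k ∈ Finset.range M,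
          1 / ((Nat.factorial k : ℝ) * w ^ k * b ^ (N + k)) *
            logLaplace (N + k) (1 / (v * w / (v + w) * b)) := by
  rw [integral_gammaMeasure hN (by positivity)]
  have hq : 0 < 1 / v + 1 / w := by positivity
  have e : ∀ x ∈ Set.Ioi (0 : ℝ), (1 / v) ^ N / Real.Gamma N * x ^ (N - 1) *
      Real.exp (-(1 / v * x)) *
      ((gammaMeasure M (1 / w)).real (Set.Ioi x) * Real.log (1 + b * x)) =
      1 / (Real.Gamma N * v ^ N) * ∑ k ∈ Finset.range M, 1 / ((Nat.factorial k : ℝ) * w ^ k) *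
        (x ^ (N + k - 1) * Real.exp (-((1 / v + 1 / w) * x)) * Real.log (1 + b * x)) := by
    intro x hx
    rw [gammaMeasure_real_Ioi hM (by positivity) (le_of_lt hx), add_mul, neg_add, Real.exp_add,
      Finset.mul_sum, Finset.sum_mul, Finset.mul_sum, Finset.mul_sum]
    refine Finset.sum_congr rfl fun k _ => ?_
    rw [show N + k - 1 = (N - 1) + k by omega, pow_add, mul_pow, one_div_pow, one_div_pow]
    have : (Nat.factorial k : ℝ) ≠ 0 := by positivity
    ring
  rw [setIntegral_congr_fun measurableSet_Ioi e, integral_const_mul, integral_finsetSum]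
  · congr 1
    refine Finset.sum_congr rfl fun k _ => ?_
    rw [integral_const_mul, integral_pow_mul_exp_mul_log (by omega) hb, ← mul_assoc]
    congr 1
    · rw [div_mul_div_comm, one_mul]
    · congr 1
      field_simp
      ring
  · intro k _
    exact (integrableOn_pow_mul_exp_mul_log (by omega) hq hb.le).const_mul _

/-! ### Pointwise rates: splitting and monotonicity. -/

section Rates

variable {an af : ℝ}

/-- After cross-multiplication the terms in `x y` cancel. Gain and power enter the SINR only through
their product, so this gives monotonicity in both. -/
lemma div_mul_add_one_le (han : 0 < an) (haf : 0 < af) {x y : ℝ} (hx : 0 ≤ x) (hxy : x ≤ y) :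
    af * x / (an * x + 1) ≤ af * y / (an * y + 1) := by
  have hy := hx.trans hxy
  rw [div_le_div_iff₀ (by positivity) (by positivity)]
  nlinarith [mul_le_mul_of_nonneg_left hxy haf.le]

lemma sinrFar_mono_gain (han : 0 < an) (haf : 0 < af) {g g' P : ℝ} (hg : 0 ≤ g) (h : g ≤ g')
    (hP : 0 ≤ P) : sinrFar an af g P ≤ sinrFar an af g' P := by
  simp only [sinrFar, mul_assoc]
  exact div_mul_add_one_le han haf (by positivity) (by gcongr)

lemma sinrFar_mono_power (han : 0 < an) (haf : 0 < af) {g P P' : ℝ} (hg : 0 ≤ g) (h : P ≤ P')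
    (hP : 0 ≤ P) : sinrFar an af g P ≤ sinrFar an af g P' := by
  simp only [sinrFar, mul_assoc]
  exact div_mul_add_one_le han haf (by positivity) (by gcongr)

lemma sinrFar_nonneg (han : 0 < an) (haf : 0 < af) {g P : ℝ} (hg : 0 ≤ g) (hP : 0 ≤ P) :
    0 ≤ sinrFar an af g P := by
  rw [sinrFar]
  positivity

lemma logb_two_one_add_le {x y : ℝ} (hx : 0 ≤ x) (h : x ≤ y) :
    Real.logb 2 (1 + x) ≤ Real.logb 2 (1 + y) :=
  Real.logb_le_logb_of_le one_lt_two (by linarith) (by linarith)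

lemma rateFar_eq (han : 0 < an) (haf : 0 < af) (hsum : an + af = 1) {gn gf P : ℝ} (hn : 0 ≤ gn)
    (hf : 0 ≤ gf) (hP : 0 ≤ P) :
    rateFar an af gn gf P
      = Real.logb 2 (1 + min gn gf * P) - Real.logb 2 (1 + an * min gn gf * P) := by
  have hmin : rateFar an af gn gf P = Real.logb 2 (1 + sinrFar an af (min gn gf) P) := by
    rcases le_total gn gf with h | h
    · rw [rateFar, min_eq_left h, min_eq_left]
      exact logb_two_one_add_le (sinrFar_nonneg han haf hn hP) (sinrFar_mono_gain han haf hn h hP)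
    · rw [rateFar, min_eq_right h, min_eq_right]
      exact logb_two_one_add_le (sinrFar_nonneg han haf hf hP) (sinrFar_mono_gain han haf hf h hP)
  have hg : 0 ≤ min gn gf := le_min hn hf
  rw [hmin, sinrFar, ← Real.logb_div (by positivity) (by positivity)]
  congr 1
  have : an * min gn gf * P + 1 ≠ 0 := by positivity
  have : 1 + an * min gn gf * P ≠ 0 := by positivity
  have haf' : af = 1 - an := by linarith
  subst haf'
  field_simp
  ring

lemma sumRate_eq (han : 0 < an) (haf : 0 < af) (hsum : an + af = 1) {gn gf P : ℝ} (hn : 0 ≤ gn)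
    (hf : 0 ≤ gf) (hP : 0 ≤ P) :
    sumRate an af gn gf P = Real.logb 2 (1 + an * gn * P) + Real.logb 2 (1 + min gn gf * P)
      - Real.logb 2 (1 + an * min gn gf * P) := by
  rw [sumRate, rateNear, rateFar_eq han haf hsum hn hf hP, add_sub_assoc]

/-- Monotonicity is read off the original minimum of rates; the split form has a term with a minus
sign. -/
lemma sumRate_mono (han : 0 < an) (haf : 0 < af) {gn gf P P' : ℝ} (hn : 0 ≤ gn)
    (hf : 0 ≤ gf) (hP : 0 ≤ P) (h : P ≤ P') :
    sumRate an af gn gf P ≤ sumRate an af gn gf P' := by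
  refine add_le_add (logb_two_one_add_le (by positivity) (by gcongr)) (min_le_min ?_ ?_)
  · exact logb_two_one_add_le (sinrFar_nonneg han haf hn hP) (sinrFar_mono_power han haf hn h hP)
  · exact logb_two_one_add_le (sinrFar_nonneg han haf hf hP) (sinrFar_mono_power han haf hf h hP)

end Rates

lemma mrcGain_nonneg {S : Type*} {N : ℕ} (h : Fin N → S → ℂ) (ω : S) : 0 ≤ mrcGain h ω :=
  Finset.sum_nonneg fun _ _ => by positivity

/-! ### The feasible powers form an interval. -/

section Feasibility

variable {S : Type*} [MeasurableSpace S] {μ : Measure S} {gp : S → ℝ} {v : ℝ}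

lemma exp_tail_le_iff {I δ P : ℝ} (hv : 0 < v) (hP : 0 < P) (hδ0 : 0 < δ)
    (hδ1 : δ < 1) : Real.exp (-(1 / v * (I / P))) ≤ δ ↔ P ≤ -I / (v * Real.log δ) := by
  have hlog : Real.log δ < 0 := Real.log_neg hδ0 hδ1
  have hneg : 0 < v * -Real.log δ := mul_pos hv (neg_pos.2 hlog)
  rw [← Real.le_log_iff_exp_le hδ0, show -I / (v * Real.log δ) = I / (v * -Real.log δ) by
    rw [mul_neg, div_neg, neg_div], le_div_iff₀ hneg, neg_le, div_mul_div_comm, one_mul,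
    le_div_iff₀ (by positivity)]
  constructor <;> intro h <;> linarith

lemma measureReal_mul_gt (hgp : HasLaw gp (gammaMeasure (1 : ℕ) (1 / v)) μ) (hv : 0 < v)
    {I P : ℝ} (hI : 0 < I) (hP : 0 < P) :
    μ.real {ω | gp ω * P > I} = Real.exp (-(1 / v * (I / P))) := by
  have e : {ω | gp ω * P > I} = {ω | I / P < gp ω} := by
    ext ω
    simp [div_lt_iff₀ hP]
  rw [e, hgp.measureReal_eq (p := fun x => I / P < x) measurableSet_Ioi]
  refine (gammaMeasure_real_Ioi le_rfl (by positivity) (by positivity)).trans ?_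
  simp

lemma measureReal_mul_ge (hgp : HasLaw gp (gammaMeasure (1 : ℕ) (1 / v)) μ) (hv : 0 < v)
    {I P : ℝ} (hI : 0 < I) (hP : 0 < P) :
    μ.real {ω | gp ω * P ≥ I} = Real.exp (-(1 / v * (I / P))) := by
  have e : {ω | gp ω * P ≥ I} = {ω | I / P ≤ gp ω} := by
    ext ω
    simp [div_le_iff₀ hP]
  rw [e, hgp.measureReal_eq (p := fun x => I / P ≤ x) measurableSet_Ici]
  refine (gammaMeasure_real_Ici _ _ _).trans
    ((gammaMeasure_real_Ioi le_rfl (by positivity) (by positivity)).trans ?_)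
  simp

lemma neg_div_mul_log_pos {I δ : ℝ} (hv : 0 < v) (hI : 0 < I) (hδ0 : 0 < δ) (hδ1 : δ < 1) :
    0 < -I / (v * Real.log δ) :=
  div_pos_of_neg_of_neg (by linarith) (mul_neg_of_pos_of_neg hv (Real.log_neg hδ0 hδ1))

lemma powersInt_eq (hgp : HasLaw gp (gammaMeasure (1 : ℕ) (1 / v)) μ) (hv : 0 < v)
    {I δ : ℝ} (hI : 0 < I) (hδ0 : 0 < δ) (hδ1 : δ < 1) :
    powersInt μ gp I δ = Set.Icc 0 (-I / (v * Real.log δ)) := by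
  ext P
  rw [powersInt, Set.mem_ofPred_eq, Set.mem_Icc]
  refine and_congr_right fun hP => ?_
  -- The tail formula divides by `P`. At `P = 0` the interference event is empty because `I > 0`.
  rcases hP.eq_or_lt with rfl | hP
  · simp [hI.not_gt, hδ0.le, (neg_div_mul_log_pos hv hI hδ0 hδ1).le]
  · rw [measureReal_mul_gt hgp hv hI hP, exp_tail_le_iff hv hP hδ0 hδ1]

lemma powersPowInt_eq (hgp : HasLaw gp (gammaMeasure (1 : ℕ) (1 / v)) μ) (hv : 0 < v)
    {I δ Q : ℝ} (hI : 0 < I) (hδ0 : 0 < δ) (hδ1 : δ < 1) :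
    powersPowInt μ gp I δ Q = Set.Icc 0 (min Q (-I / (v * Real.log δ))) := by
  ext P
  rw [powersPowInt, Set.mem_ofPred_eq, Set.mem_Icc, le_min_iff, and_comm (a := P ≤ Q)]
  refine and_congr_right fun hP => and_congr_left fun _ => ?_
  rcases hP.eq_or_lt with rfl | hP
  · simp [hI.not_ge, hδ0.le, (neg_div_mul_log_pos hv hI hδ0 hδ1).le]
  · rw [measureReal_mul_ge hgp hv hI hP, exp_tail_le_iff hv hP hδ0 hδ1]

end Feasibility

lemma isGreatest_image_Icc_of_monotoneOn {f : ℝ → ℝ} {a b : ℝ} (hf : MonotoneOn f (Set.Ici a))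
    (hab : a ≤ b) : IsGreatest (f '' Set.Icc a b) (f b) := by
  refine ⟨⟨b, ⟨hab, le_rfl⟩, rfl⟩, ?_⟩
  rintro _ ⟨x, hx, rfl⟩
  exact hf hx.1 hab hx.2

/-! ### Expectations of logarithms of the gains. -/

section Expectations

variable {S : Type*} [MeasurableSpace S] {μ : Measure S} {N : ℕ} {v : ℝ} {g : S → ℝ}

lemma integrable_comp_of_hasLaw {X : S → ℝ} {ν : Measure ℝ} (hX : HasLaw X ν μ) {f : ℝ → ℝ}
    (hf : Integrable f ν) : Integrable (fun ω => f (X ω)) μ := by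
  rw [← hX.map_eq] at hf
  exact hf.comp_aemeasurable hX.aemeasurable

lemma integrable_log_gain (hN : 1 ≤ N) (hv : 0 < v) (hg : HasLaw g (gammaMeasure N (1 / v)) μ)
    {b : ℝ} (hb : 0 ≤ b) : Integrable (fun ω => Real.log (1 + b * g ω)) μ :=
  integrable_comp_of_hasLaw hg (integrable_log_one_add_gammaMeasure hN (by positivity) hb)

lemma integral_log_gain (hN : 1 ≤ N) (hv : 0 < v) (hg : HasLaw g (gammaMeasure N (1 / v)) μ)
    {b : ℝ} (hb : 0 < b) : ∫ ω, Real.log (1 + b * g ω) ∂μ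
      = 1 / (Real.Gamma N * v ^ N * b ^ N) * logLaplace N (1 / (v * b)) := by
  rw [← integral_log_gammaMeasure hN hv hb]
  exact hg.integral_comp (f := fun x => Real.log (1 + b * x))
    (Measurable.aestronglyMeasurable (by fun_prop))

variable {M : ℕ} {w : ℝ} {g' : S → ℝ}

lemma integrable_log_min_gain (hN : 1 ≤ N) (hv : 0 < v) (hg : HasLaw g (gammaMeasure N (1 / v)) μ)
    (hM : 1 ≤ M) (hw : 0 < w) (hg' : HasLaw g' (gammaMeasure M (1 / w)) μ)
    {b : ℝ} (hb : 0 ≤ b) :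
    Integrable (fun ω => Real.log (1 + b * min (g ω) (g' ω))) μ := by
  have h1 := integrable_log_gain hN hv hg hb
  have h2 := integrable_log_gain hM hw hg' hb
  refine (h1.norm.add h2.norm).mono' ?_ (ae_of_all _ fun ω => ?_)
  · have := hg.aemeasurable
    have := hg'.aemeasurable
    exact AEMeasurable.aestronglyMeasurable (by fun_prop)
  · simp only [Pi.add_apply]
    rcases min_choice (g ω) (g' ω) with h | h <;> rw [h]
    · linarith [norm_nonneg (Real.log (1 + b * g' ω))]
    · linarith [norm_nonneg (Real.log (1 + b * g ω))]

lemma integral_log_min_gain [IsProbabilityMeasure μ] (hN : 1 ≤ N) (hv : 0 < v)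
    (hg : HasLaw g (gammaMeasure N (1 / v)) μ)
    (hM : 1 ≤ M) (hw : 0 < w) (hg' : HasLaw g' (gammaMeasure M (1 / w)) μ)
    (hind : IndepFun g g' μ) {b : ℝ} (hb : 0 < b) :
    ∫ ω, Real.log (1 + b * min (g ω) (g' ω)) ∂μ
      = 1 / (Real.Gamma N * v ^ N) * (∑ k ∈ Finset.range M,
          1 / ((Nat.factorial k : ℝ) * w ^ k * b ^ (N + k)) *
            logLaplace (N + k) (1 / (v * w / (v + w) * b)))
        + 1 / (Real.Gamma M * w ^ M) * ∑ l ∈ Finset.range N,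
          1 / ((Nat.factorial l : ℝ) * v ^ l * b ^ (M + l)) *
            logLaplace (M + l) (1 / (v * w / (v + w) * b)) := by
  have : IsProbabilityMeasure (gammaMeasure N (1 / v)) := hg.isProbabilityMeasure_iff.1 ‹_›
  have : IsProbabilityMeasure (gammaMeasure M (1 / w)) := hg'.isProbabilityMeasure_iff.1 ‹_›
  have hjoint := (indepFun_iff_hasLaw_prodMk_prod hg hg').1 hind
  have h := hjoint.integral_comp (f := fun p : ℝ × ℝ => Real.log (1 + b * min p.1 p.2))
    (Measurable.aestronglyMeasurable (by fun_prop))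
  have h2 := (integral_comp_min_prod (φ := fun x => Real.log (1 + b * x))
    (integrable_log_one_add_gammaMeasure hN (r := 1 / v) (by positivity) hb.le)
    (integrable_log_one_add_gammaMeasure hM (r := 1 / w) (by positivity) hb.le)).2
  simp_rw [gammaMeasure_real_Ici] at h2
  -- Commuting `v` and `w` in the second sum gives both sums the same `v w / (v + w)`.
  rw [integral_tail_mul_log_gammaMeasure hN hM hv hw hb,
    integral_tail_mul_log_gammaMeasure hM hN hw hv hb, mul_comm w v, add_comm w v] at h2
  exact h.trans h2

end Expectations

lemma rateG_eq_logLaplace {N : ℕ} (hN : 1 ≤ N) {z : ℝ} (hz : 0 < z) :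
    rateG N z = (logLaplace N z : ℂ) := rateG_eq_integral hN hz

/-- The closed form is real, and its bracketed differences regroup into the three expectations,
taken at scales `a_n P`, `P` and `a_n P`. -/
lemma sumRateClosedForm_eq {Nn Nf : ℕ} (hNn : 1 ≤ Nn) (hNf : 1 ≤ Nf) {Ωn Ωf an P : ℝ}
    (hΩn : 0 < Ωn) (hΩf : 0 < Ωf) (han : 0 < an) (hP : 0 < P) :
    sumRateClosedForm Nn Nf Ωn Ωf an P =
      (((1 / (Real.Gamma Nn * Ωn ^ Nn * (an * P) ^ Nn) * logLaplace Nn (1 / (Ωn * (an * P)))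
        + (1 / (Real.Gamma Nn * Ωn ^ Nn) * (∑ k ∈ Finset.range Nf,
            1 / ((Nat.factorial k : ℝ) * Ωf ^ k * P ^ (Nn + k)) *
              logLaplace (Nn + k) (1 / (Ωn * Ωf / (Ωn + Ωf) * P)))
          + 1 / (Real.Gamma Nf * Ωf ^ Nf) * ∑ l ∈ Finset.range Nn,
            1 / ((Nat.factorial l : ℝ) * Ωn ^ l * P ^ (Nf + l)) *
              logLaplace (Nf + l) (1 / (Ωn * Ωf / (Ωn + Ωf) * P)))
        - (1 / (Real.Gamma Nn * Ωn ^ Nn) * (∑ k ∈ Finset.range Nf,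
            1 / ((Nat.factorial k : ℝ) * Ωf ^ k * (an * P) ^ (Nn + k)) *
              logLaplace (Nn + k) (1 / (Ωn * Ωf / (Ωn + Ωf) * (an * P))))
          + 1 / (Real.Gamma Nf * Ωf ^ Nf) * ∑ l ∈ Finset.range Nn,
            1 / ((Nat.factorial l : ℝ) * Ωn ^ l * (an * P) ^ (Nf + l)) *
              logLaplace (Nf + l) (1 / (Ωn * Ωf / (Ωn + Ωf) * (an * P))))) / Real.log 2 : ℝ) : ℂ) := by
  have hsum : ∀ (A B : ℕ), 1 ≤ A → ∀ y : ℝ, ∑ k ∈ Finset.range B,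
      1 / ((Nat.factorial k : ℂ) * (y : ℂ) ^ k * (P : ℂ) ^ (A + k)) *
        (rateG (A + k) (1 / (Ωn * Ωf / (Ωn + Ωf) * P))
          - 1 / (an : ℂ) ^ (A + k) * rateG (A + k) (1 / (Ωn * Ωf / (Ωn + Ωf) * an * P)))
      = ((((∑ k ∈ Finset.range B, 1 / ((Nat.factorial k : ℝ) * y ^ k * P ^ (A + k)) *
            logLaplace (A + k) (1 / (Ωn * Ωf / (Ωn + Ωf) * P)))
          - ∑ k ∈ Finset.range B, 1 / ((Nat.factorial k : ℝ) * y ^ k * (an * P) ^ (A + k)) *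
              logLaplace (A + k) (1 / (Ωn * Ωf / (Ωn + Ωf) * (an * P)))) : ℝ) : ℂ) := by
    intro A B hA y
    rw [← Finset.sum_sub_distrib, Complex.ofReal_sum]
    refine Finset.sum_congr rfl fun k _ => ?_
    rw [rateG_eq_logLaplace (by omega) (by positivity),
      rateG_eq_logLaplace (by omega) (by positivity), mul_assoc _ an P]
    push_cast
    rw [mul_pow]
    ring
  rw [sumRateClosedForm]
  rw [hsum Nn Nf hNn Ωf, hsum Nf Nn hNf Ωn, rateG_eq_logLaplace hNn (by positivity),
    mul_assoc Ωn an P]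
  push_cast
  ring

/-! ### The average sum-rate and the optimal powers. -/

section AverageRate

variable {S : Type*} [MeasurableSpace S] {μ : Measure S} {gn gf : S → ℝ} {Nn Nf : ℕ}
  {Ωn Ωf an af : ℝ}

/-- Integrability of the sum-rate and its splitting into three expectations. -/
lemma avgSumRate_eq (hNn : 1 ≤ Nn) (hNf : 1 ≤ Nf) (hΩn : 0 < Ωn) (hΩf : 0 < Ωf)
    (hgn : HasLaw gn (gammaMeasure Nn (1 / Ωn)) μ) (hgf : HasLaw gf (gammaMeasure Nf (1 / Ωf)) μ)
    (hn0 : ∀ ω, 0 ≤ gn ω) (hf0 : ∀ ω, 0 ≤ gf ω)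
    (han : 0 < an) (haf : 0 < af) (hsum : an + af = 1) {P : ℝ} (hP : 0 ≤ P) :
    Integrable (fun ω => sumRate an af (gn ω) (gf ω) P) μ ∧
    Integrable (fun ω => Real.logb 2 (1 + an * gn ω * P)) μ ∧
    Integrable (fun ω => Real.logb 2 (1 + min (gn ω) (gf ω) * P)) μ ∧
    Integrable (fun ω => Real.logb 2 (1 + an * min (gn ω) (gf ω) * P)) μ ∧
    avgSumRate μ gn gf an af P = (∫ ω, Real.logb 2 (1 + an * gn ω * P) ∂μ)
      + (∫ ω, Real.logb 2 (1 + min (gn ω) (gf ω) * P) ∂μ)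
      - ∫ ω, Real.logb 2 (1 + an * min (gn ω) (gf ω) * P) ∂μ := by
  have haP : 0 ≤ an * P := by positivity
  have i1 : Integrable (fun ω => Real.logb 2 (1 + an * gn ω * P)) μ := by
    simp_rw [Real.logb, mul_right_comm an _ P]
    exact (integrable_log_gain hNn hΩn hgn haP).div_const _
  have i2 : Integrable (fun ω => Real.logb 2 (1 + min (gn ω) (gf ω) * P)) μ := by
    simp_rw [Real.logb, mul_comm _ P]
    exact (integrable_log_min_gain hNn hΩn hgn hNf hΩf hgf hP).div_const _
  have i3 : Integrable (fun ω => Real.logb 2 (1 + an * min (gn ω) (gf ω) * P)) μ := by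
    simp_rw [Real.logb, mul_right_comm an _ P]
    exact (integrable_log_min_gain hNn hΩn hgn hNf hΩf hgf haP).div_const _
  have e := fun ω => sumRate_eq han haf hsum (hn0 ω) (hf0 ω) hP
  refine ⟨?_, i1, i2, i3, ?_⟩
  · simp_rw [e]
    exact (i1.add i2).sub i3
  · simp_rw [avgSumRate, e]
    exact (integral_sub (i1.add i2) i3).trans (congrArg (· - _) (integral_add i1 i2))

/-- Independence of the two gains is what evaluates the expectations of the minimum; `P > 0` keeps
the Meijer arguments positive. -/
lemma avgSumRate_eq_closedForm [IsProbabilityMeasure μ] (hNn : 1 ≤ Nn) (hNf : 1 ≤ Nf)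
    (hΩn : 0 < Ωn) (hΩf : 0 < Ωf)
    (hgn : HasLaw gn (gammaMeasure Nn (1 / Ωn)) μ) (hgf : HasLaw gf (gammaMeasure Nf (1 / Ωf)) μ)
    (hind : IndepFun gn gf μ) (hn0 : ∀ ω, 0 ≤ gn ω) (hf0 : ∀ ω, 0 ≤ gf ω)
    (han : 0 < an) (haf : 0 < af) (hsum : an + af = 1) {P : ℝ} (hP : 0 < P) :
    (avgSumRate μ gn gf an af P : ℂ) = sumRateClosedForm Nn Nf Ωn Ωf an P := by
  have haP : 0 < an * P := by positivity
  rw [sumRateClosedForm_eq hNn hNf hΩn hΩf han hP,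
    (avgSumRate_eq hNn hNf hΩn hΩf hgn hgf hn0 hf0 han haf hsum hP.le).2.2.2.2]
  simp_rw [Real.logb, mul_right_comm an _ P, mul_comm (min _ _) P, integral_div]
  rw [integral_log_gain hNn hΩn hgn haP, integral_log_min_gain hNn hΩn hgn hNf hΩf hgf hind hP,
    integral_log_min_gain hNn hΩn hgn hNf hΩf hgf hind haP, ← add_div, ← sub_div]

end AverageRate

theorem theorem4 {S : Type*} [MeasurableSpace S] (μ : Measure S) [IsProbabilityMeasure μ]
    (Nn Nf : ℕ) (hNn : 1 ≤ Nn) (hNf : 1 ≤ Nf)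
    (Ωp Ωn Ωf : ℝ) (hΩp : 0 < Ωp) (hΩn : 0 < Ωn) (hΩf : 0 < Ωf)
    (an af : ℝ) (han : 0 < an) (haf : 0 < af) (hsum : an + af = 1)
    (I δ Ppeak : ℝ) (hI : 0 < I) (hδ0 : 0 < δ) (hδ1 : δ < 1) (hPpeak : 0 < Ppeak)
    (hp : S → ℂ) (hn : Fin Nn → S → ℂ) (hf : Fin Nf → S → ℂ)
    (hp_law : HasLaw hp (complexNormal Ωp) μ)
    (hn_law : ∀ i, HasLaw (hn i) (complexNormal Ωn) μ)
    (hf_law : ∀ j, HasLaw (hf j) (complexNormal Ωf) μ)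
    (h_indep : iIndepFun (Sum.elim hn hf) μ) :
    let gp : S → ℝ := fun ω => ‖hp ω‖ ^ 2
    let gn : S → ℝ := mrcGain hn
    let gf : S → ℝ := mrcGain hf
    let gmin : S → ℝ := fun ω => min (gn ω) (gf ω)
    let Csum : ℝ → ℝ := fun P => avgSumRate μ gn gf an af P
    let Pint : ℝ := -I / (Ωp * Real.log δ)
    let Ppow : ℝ := min Ppeak (-I / (Ωp * Real.log δ))
    -- IntSCSI: the optimal power and the sum-rate
    (Pint ∈ powersInt μ gp I δ ∧ IsGreatest (Csum '' powersInt μ gp I δ) (Csum Pint) ∧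
      (Csum Pint : ℂ) = sumRateClosedForm Nn Nf Ωn Ωf an Pint) ∧
    -- PowIntSCSI: the optimal power and the sum-rate
    (Ppow ∈ powersPowInt μ gp I δ Ppeak ∧
      IsGreatest (Csum '' powersPowInt μ gp I δ Ppeak) (Csum Ppow) ∧
      (Csum Ppow : ℂ) = sumRateClosedForm Nn Nf Ωn Ωf an Ppow) ∧
    -- the expectations are those of integrable variables, and the sum-rate splits into three
    (∀ P : ℝ, 0 ≤ P →
      Integrable (fun ω => sumRate an af (gn ω) (gf ω) P) μ ∧
      Integrable (fun ω => Real.logb 2 (1 + an * gn ω * P)) μ ∧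
      Integrable (fun ω => Real.logb 2 (1 + gmin ω * P)) μ ∧
      Integrable (fun ω => Real.logb 2 (1 + an * gmin ω * P)) μ ∧
      Csum P = (∫ ω, Real.logb 2 (1 + an * gn ω * P) ∂μ)
        + (∫ ω, Real.logb 2 (1 + gmin ω * P) ∂μ)
        - ∫ ω, Real.logb 2 (1 + an * gmin ω * P) ∂μ) ∧
    -- the Meijer functions in the closed form are given by convergent integrals
    (∀ N : ℕ, 1 ≤ N → ∀ z : ℝ, 0 < z →
      MeijerGWellDefined 3 1 (rateUpper N) (rateLower N) (z : ℂ)) := by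
  have hgp := hasLaw_normSq hΩp hp_law
  have hgn : HasLaw (mrcGain hn) (gammaMeasure Nn (1 / Ωn)) μ :=
    hasLaw_mrcGain hNn hΩn hn_law
      (iIndepFun.precomp (f := Sum.elim hn hf) Sum.inl_injective h_indep)
  have hgf : HasLaw (mrcGain hf) (gammaMeasure Nf (1 / Ωf)) μ :=
    hasLaw_mrcGain hNf hΩf hf_law
      (iIndepFun.precomp (f := Sum.elim hn hf) Sum.inr_injective h_indep)
  have hind : IndepFun (mrcGain hn) (mrcGain hf) μ :=
    indepFun_mrcGain (fun i => (hn_law i).aemeasurable) (fun j => (hf_law j).aemeasurable) h_indep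
  have hn0 := mrcGain_nonneg hn
  have hf0 := mrcGain_nonneg hf
  have hsplit := fun (P : ℝ) (hP : 0 ≤ P) =>
    avgSumRate_eq hNn hNf hΩn hΩf hgn hgf hn0 hf0 han haf hsum hP
  have hmono : MonotoneOn (fun P => avgSumRate μ (mrcGain hn) (mrcGain hf) an af P)
      (Set.Ici 0) := fun P hP P' hP' h =>
    integral_mono (hsplit P hP).1 (hsplit P' hP').1 fun ω =>
      sumRate_mono han haf (hn0 ω) (hf0 ω) hP h
  have hint0 := neg_div_mul_log_pos hΩp hI hδ0 hδ1
  have hpow0 : 0 < min Ppeak (-I / (Ωp * Real.log δ)) := lt_min hPpeak hint0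
  intro gp gn gf gmin Csum Pint Ppow
  have eint : powersInt μ gp I δ = Set.Icc 0 Pint := powersInt_eq hgp hΩp hI hδ0 hδ1
  have epow : powersPowInt μ gp I δ Ppeak = Set.Icc 0 Ppow := powersPowInt_eq hgp hΩp hI hδ0 hδ1
  rw [eint, epow]
  exact ⟨⟨Set.right_mem_Icc.2 hint0.le, isGreatest_image_Icc_of_monotoneOn hmono hint0.le,
      avgSumRate_eq_closedForm hNn hNf hΩn hΩf hgn hgf hind hn0 hf0 han haf hsum hint0⟩,
    ⟨Set.right_mem_Icc.2 hpow0.le, isGreatest_image_Icc_of_monotoneOn hmono hpow0.le,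
      avgSumRate_eq_closedForm hNn hNf hΩn hΩf hgn hgf hind hn0 hf0 han haf hsum hpow0⟩,
    hsplit, fun N hN z hz => meijerGWellDefined_rate hN hz⟩
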